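/- Let the state space be $[0,1]$, with a common prior $F$ that has a strictly positive density. Receiver has two actions $a_0,a_1$; for a cutoff $\gamma\in[0,1]$, $a_0$ is optimal if and only if the posterior mean $x$ of the state lies in $[0,\gamma]$, and $a_1$ is optimal if and only if $x\in[\gamma,1]$. Sender's payoff depends only on Receiver's action, with $v(a_1)>v(a_0)=0$; let $u(x)$ be the highest value of $v$ over the actions that are optimal at posterior mean $x$. *Information design problem.* Maximize $\int u\,dG$ over $G\in\mathrm{MPC}(F)$, the set of probability distributions $G$ on $[0,1]$ with $\int_0^x G(s)\,ds\le\int_0^x F(s)\,ds$ for all $x\in[0,1]$ and equality at $x=1$; its value is the commitment payoff $R_c$. A distribution $G\in\mathrm{MPC}(F)$ is bi-pooling if there is a collection of nondegenerate, non-overlapping intervals $[\underline\omega_i,\overline\omega_i]\subseteq[0,1]$ (common endpoints are allowed) such that $G(\overline\omega_i)-G(\underline\omega_i)=F(\overline\omega_i)-F(\underline\omega_i)$ and the restriction of $G$ to $[\underline\omega_i,\overline\omega_i]$ has at most two points in its support, for every $i$, and $G$ and $F$ coincide as measures on $[0,1]\setminus\bigcup_i[\underline\omega_i,\overline\omega_i]$.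 A bi-pooling solution is a bi-pooling distribution that solves the problem. *Verifiable disclosure game.* Let $\mathcal C$ be the space of nonempty closed subsets of $[0,1]$ with the Hausdorff distance. Sender observes the state $\omega$ and sends a message $m\in\mathcal C$ with $\omega\in m$; Receiver observes $m$ and chooses an action. Strategies $\sigma:[0,1]\to\Delta(\mathcal C)$ (with $\sigma(\omega)$ supported on the messages containing $\omega$) and $\tau:\mathcal C\to\Delta(\{a_0,a_1\})$ and a belief system $p:\mathcal C\to\Delta([0,1])$, all measurable, form an equilibrium if: (1) for every $\omega$, $\operatorname{supp}\sigma(\omega)$ is contained in the set of maximizers of $v(\tau(m))$ over the messages $m$ containing $\omega$, where $v(\tau(m))$ is Sender's expected payoff under $\tau(m)$; (2) for every $m\in\mathcal C$, every action that has positive probability under $\tau(m)$ is optimal at the mean of $p(m)$; (3) $\operatorname{supp}p(m)\subseteq m$ for every $m\in\mathcal C$; (4) $p$ is obtained from $F$ and $\sigma$ by Bayes' rule. The outcome of an equilibrium is $(G,R)$, where $G$ is the induced distribution of Receiver's posterior mean and $R$ is Sender's ex ante expected payoff. Claim: for every bi-pooling solution $G$, the pair $(G,R_c)$ is the outcome of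 some equilibrium of the verifiable disclosure game; that is, every bi-pooling solution is implementable. -/

import Mathlib

open MeasureTheory ProbabilityTheory Set TopologicalSpace
open scoped unitInterval

noncomputable section

namespace VerifiableDisclosure

/-- The collection of nonempty closed (equivalently, nonempty compact) subsets of `[0,1]`,
a metric space under the Hausdorff distance. -/
abbrev Message : Type := NonemptyCompacts I

instance : MeasurableSpace Message := borel Message

instance : BorelSpace Message := ⟨rfl⟩

/-- The expectation of a probability measure on `[0,1]`, as a point of `[0,1]`. -/
def mean (μ : Measure I) [IsProbabilityMeasure μ] : I :=
  ⟨∫ ω, (ω : ℝ) ∂μ,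
    integral_nonneg fun ω => ω.2.1,
    by
      have h : ∫ ω, (ω : ℝ) ∂μ ≤ ∫ _ω, (1 : ℝ) ∂μ := by
        refine integral_mono_of_nonneg (Filter.Eventually.of_forall fun ω => ω.2.1)
          (integrable_const 1) (Filter.Eventually.of_forall fun ω => ω.2.2)
      simpa using h⟩

/-- The communication environment with `n` ordered receiver actions `a_0, …, a_{n-1}`
(indexed by `Fin n`): the common prior `F` has a strictly positive density on `[0,1]`; `a_i` is
optimal for the receiver iff the posterior mean lies in `[cutoff i, cutoff (i+1)]`; the sender's
payoff `v` is strictly increasing in the action, with `v a_0 = 0`. -/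
structure Environment (n : ℕ) where
  prior : ProbabilityMeasure I
  density : I → ℝ
  measurable_density : Measurable density
  density_pos : ∀ ω, 0 < density ω
  prior_eq : (prior : Measure I) = volume.withDensity fun ω => ENNReal.ofReal (density ω)
  cutoff : Fin (n + 1) → I
  cutoff_zero : cutoff 0 = 0
  cutoff_last : cutoff (Fin.last n) = 1
  cutoff_mono : Monotone cutoff
  v : Fin n → ℝ
  v_zero : ∀ i : Fin n, (i : ℕ) = 0 → v i = 0
  v_strictMono : StrictMono v

/-- `G` is a mean-preserving contraction of `F`: the integrals of the distribution functions
satisfy `∫₀ˣ G ≤ ∫₀ˣ F` for all `x ∈ [0,1]`, with equality at `x = 1`. -/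
def IsMPC (F G : ProbabilityMeasure I) : Prop :=
  (∀ x : I, ∫ s in Iic x, (G : Measure I).real (Iic s) ≤
      ∫ s in Iic x, (F : Measure I).real (Iic s)) ∧
    ∫ s : I, (G : Measure I).real (Iic s) = ∫ s : I, (F : Measure I).real (Iic s)

/-- Bi-pooling distributions. The family `J` consists of the (nondegenerate) intervals
`[q.1, q.2]`. They may share endpoints, but do not overlap otherwise. -/
def IsBiPooling (F G : ProbabilityMeasure I) : Prop :=
  IsMPC F G ∧ ∃ J : Set (I × I),
    (∀ q ∈ J, q.1 < q.2) ∧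
    J.Pairwise (fun q r => Disjoint (Ioo q.1 q.2) (Ioo r.1 r.2)) ∧
    (∀ q ∈ J,
      (G : Measure I).real (Iic q.2) - (G : Measure I).real (Iic q.1) =
          (F : Measure I).real (Iic q.2) - (F : Measure I).real (Iic q.1) ∧
        ((G : Measure I).restrict (Icc q.1 q.2)).support.encard ≤ 2) ∧
    (G : Measure I).restrict (⋃ q ∈ J, Icc q.1 q.2)ᶜ =
      (F : Measure I).restrict (⋃ q ∈ J, Icc q.1 q.2)ᶜ

/-- A strategy profile together with a belief system: the sender's strategy `[0,1] → Δ(Message)`,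
with messages containing the true state; the receiver's strategy `Message → Δ(A)`; and the
receiver's beliefs `Message → Δ([0,1])`. -/
structure Assessment (n : ℕ) where
  sender : Kernel I Message
  receiver : Kernel Message (Fin n)
  belief : Kernel Message I
  [sender_markov : IsMarkovKernel sender]
  [receiver_markov : IsMarkovKernel receiver]
  [belief_markov : IsMarkovKernel belief]
  sender_feasible : ∀ ω : I, (sender ω).support ⊆ {m : Message | ω ∈ m}

attribute [instance] Assessment.sender_markov Assessment.receiver_markov
  Assessment.belief_markov

namespace Environment

variable {n : ℕ} (E : Environment n)

/-- The set of posterior means at which action `a_i` is optimal. -/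
def optimalRegion (i : Fin n) : Set I := Icc (E.cutoff i.castSucc) (E.cutoff i.succ)

/-- The sender's value function: her highest payoff from an action that is optimal for the
receiver at posterior mean `x`. -/
def valueFn (x : I) : ℝ := sSup (E.v '' {i | x ∈ E.optimalRegion i})

/-- `G` solves `max {∫ u dG : G ∈ MPC(F)}`. -/
def IsOptimalSignal (G : ProbabilityMeasure I) : Prop :=
  IsMPC E.prior G ∧ ∀ G' : ProbabilityMeasure I, IsMPC E.prior G' →
    ∫ x, E.valueFn x ∂(G' : Measure I) ≤ ∫ x, E.valueFn x ∂(G : Measure I)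

/-- The value of the information design problem. -/
def commitmentPayoff : ℝ :=
  sSup {r | ∃ G : ProbabilityMeasure I, IsMPC E.prior G ∧ r = ∫ x, E.valueFn x ∂(G : Measure I)}

def IsBiPoolingSolution (G : ProbabilityMeasure I) : Prop :=
  IsBiPooling E.prior G ∧ E.IsOptimalSignal G

/-- The sender's expected payoff `v(τ(m))` from message `m`. -/
def messagePayoff (s : Assessment n) (m : Message) : ℝ :=
  ∑ i, (s.receiver m).real {i} * E.v i

/-- Distribution of messages from the ex ante point of view. -/
def messageLaw (s : Assessment n) : Measure Message :=
  (E.prior : Measure I).bind s.sender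

/-- Perfect Bayesian equilibrium. -/
structure IsEquilibrium (s : Assessment n) : Prop where
  sender_optimal : ∀ ω : I, (s.sender ω).support ⊆
    {m : Message | ω ∈ m ∧ ∀ m' : Message, ω ∈ m' → E.messagePayoff s m' ≤ E.messagePayoff s m}
  receiver_optimal : ∀ (m : Message) (i : Fin n), 0 < s.receiver m {i} →
    mean (s.belief m) ∈ E.optimalRegion i
  belief_verifiable : ∀ (ω : I) (m : Message), ω ∉ m → ω ∉ (s.belief m).support
  /-- Bayes' rule: message law and beliefs disintegrate the joint law of states and messages. -/
  bayes : ∀ (A : Set I) (B : Set Message), MeasurableSet A → MeasurableSet B →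
    ∫⁻ ω in A, s.sender ω B ∂(E.prior : Measure I) = ∫⁻ m in B, s.belief m A ∂(E.messageLaw s)

/-- The induced outcome: `G` is the distribution of posterior means, `R` is the sender's ex ante
payoff. -/
def Induces (s : Assessment n) (G : ProbabilityMeasure I) (R : ℝ) : Prop :=
  (G : Measure I) = (E.messageLaw s).map (fun m => mean (s.belief m)) ∧
    R = ∫ m, E.messagePayoff s m ∂(E.messageLaw s)

def IsEquilibriumOutcome (G : ProbabilityMeasure I) (R : ℝ) : Prop :=
  ∃ s : Assessment n, E.IsEquilibrium s ∧ E.Induces s G R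

/-- An optimal signal distribution is implementable if, paired with the commitment payoff, it is
an equilibrium outcome of the verifiable disclosure game. -/
def Implementable (G : ProbabilityMeasure I) : Prop :=
  E.IsOptimalSignal G ∧ E.IsEquilibriumOutcome G E.commitmentPayoff

end Environment

end VerifiableDisclosure

end

namespace VerifiableDisclosure

/-- The quantile function of a probability measure on `[0,1]`. -/
noncomputable def quantile (μ : Measure I) (u : I) : I := sInf {t : I | (u : ℝ) ≤ μ.real (Iic t)}

theorem quantile_le_iff (μ : Measure I) [IsProbabilityMeasure μ] (u t : I) :
    quantile μ u ≤ t ↔ (u : ℝ) ≤ μ.real (Iic t) := by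
  have hmono : ∀ s t : I, s ≤ t → μ.real (Iic s) ≤ μ.real (Iic t) := fun s t h =>
    measureReal_mono (Iic_subset_Iic.2 h)
  refine ⟨fun h => ?_, fun h => sInf_le h⟩
  have hne : {t : I | (u : ℝ) ≤ μ.real (Iic t)}.Nonempty := by
    refine ⟨1, ?_⟩
    have : Iic (1 : I) = univ := eq_univ_of_forall fun x => x.2.2
    simp [this, u.2.2]
  obtain ⟨v, hv, hlim, hmem⟩ := exists_seq_tendsto_sInf hne (OrderBot.bddBelow _)
  refine le_trans ?_ (hmono _ _ h)
  have h1 := tendsto_measure_iInter_atTop (μ := μ) (s := fun n => Iic (v n))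
    (fun i => measurableSet_Iic.nullMeasurableSet)
    (fun i j hij => Iic_subset_Iic.2 (hv hij)) ⟨0, measure_ne_top _ _⟩
  have h2 : ⋂ n, Iic (v n) = Iic (quantile μ u) := by
    ext x
    simp only [mem_iInter, mem_Iic]
    refine ⟨fun hx => ge_of_tendsto' hlim hx, fun hx n => hx.trans (sInf_le (hmem n))⟩
  rw [h2] at h1
  have h3 : Filter.Tendsto (fun n => μ.real (Iic (v n))) Filter.atTop
      (nhds (μ.real (Iic (quantile μ u)))) :=
    (ENNReal.tendsto_toReal (measure_ne_top _ _)).comp h1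
  exact ge_of_tendsto' h3 hmem

theorem monotone_quantile (μ : Measure I) [IsProbabilityMeasure μ] : Monotone (quantile μ) :=
  fun _ v h => (quantile_le_iff μ _ _).2
    ((Subtype.coe_le_coe.2 h).trans ((quantile_le_iff μ v _).1 le_rfl))

theorem measurable_quantile (μ : Measure I) [IsProbabilityMeasure μ] : Measurable (quantile μ) :=
  (monotone_quantile μ).measurable

theorem map_quantile (μ : Measure I) [IsProbabilityMeasure μ] :
    (volume : Measure I).map (quantile μ) = μ := by
  refine Measure.ext_of_Iic _ _ fun t => ?_
  rw [Measure.map_apply (measurable_quantile μ) measurableSet_Iic]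
  have : quantile μ ⁻¹' Iic t = Iic (⟨μ.real (Iic t), measureReal_nonneg, measureReal_le_one⟩ : I) := by
    ext u
    exact quantile_le_iff μ u t
  rw [this, unitInterval.volume_Iic]
  simp

theorem quantile_le_quantile {μ ν : Measure I} [IsProbabilityMeasure μ] [IsProbabilityMeasure ν]
    (h : ∀ t, ν (Iic t) ≤ μ (Iic t)) (u : I) : quantile μ u ≤ quantile ν u := by
  rw [quantile_le_iff]
  refine ((quantile_le_iff ν u _).1 le_rfl).trans ?_
  exact ENNReal.toReal_mono (measure_ne_top _ _) (h _)

/-- First-order stochastic dominance is witnessed by an ordered coupling. -/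
theorem exists_ordered_coupling (μ ν : Measure I) [IsFiniteMeasure μ] [IsFiniteMeasure ν]
    (huniv : μ univ = ν univ) (h : ∀ t, ν (Iic t) ≤ μ (Iic t)) :
    ∃ κ : Measure (I × I), IsFiniteMeasure κ ∧ κ.map Prod.fst = μ ∧ κ.map Prod.snd = ν ∧
      ∀ᵐ z ∂κ, z.1 ≤ z.2 := by
  rcases eq_or_ne (μ univ) 0 with h0 | h0
  · refine ⟨0, inferInstance, ?_, ?_, by simp⟩
    · simp [Measure.measure_univ_eq_zero.1 h0]
    · simp [Measure.measure_univ_eq_zero.1 (huniv ▸ h0)]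
  set c := μ univ with hc
  have hct : c ≠ ⊤ := measure_ne_top _ _
  have hinv : c⁻¹ ≠ ⊤ := ENNReal.inv_ne_top.2 h0
  have hp : IsProbabilityMeasure (c⁻¹ • μ) := ⟨by
    simp [← hc, ENNReal.inv_mul_cancel h0 hct]⟩
  have hq : IsProbabilityMeasure (c⁻¹ • ν) := ⟨by
    simp [← huniv, ENNReal.inv_mul_cancel h0 hct]⟩
  have hm : Measurable fun u : I => (quantile (c⁻¹ • μ) u, quantile (c⁻¹ • ν) u) :=
    (measurable_quantile _).prodMk (measurable_quantile _)
  have hsmul : ∀ ρ : Measure I, c • c⁻¹ • ρ = ρ := fun ρ => by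
    rw [smul_smul, ENNReal.mul_inv_cancel h0 hct, one_smul]
  refine ⟨c • (volume : Measure I).map fun u => (quantile (c⁻¹ • μ) u, quantile (c⁻¹ • ν) u),
    ?_, ?_, ?_, ?_⟩
  · have : IsProbabilityMeasure ((volume : Measure I).map fun u =>
      (quantile (c⁻¹ • μ) u, quantile (c⁻¹ • ν) u)) := Measure.isProbabilityMeasure_map hm.aemeasurable
    exact Measure.smul_finite _ hct
  · rw [Measure.map_smul, Measure.map_map measurable_fst hm]
    exact (congrArg (c • ·) (map_quantile (c⁻¹ • μ))).trans (hsmul μ)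
  · rw [Measure.map_smul, Measure.map_map measurable_snd hm]
    exact (congrArg (c • ·) (map_quantile (c⁻¹ • ν))).trans (hsmul ν)
  · refine Measure.ae_smul_measure ?_ c
    rw [ae_map_iff hm.aemeasurable (measurableSet_le measurable_fst measurable_snd)]
    refine Filter.Eventually.of_forall fun u => quantile_le_quantile (fun t => ?_) u
    simp only [Measure.smul_apply, smul_eq_mul]
    exact mul_le_mul_right (h t) _

theorem integrable_coe_comp {α : Type*} [MeasurableSpace α] (μ : Measure α) [IsFiniteMeasure μ]
    {f : α → I} (hf : Measurable f) : Integrable (fun a => (f a : ℝ)) μ := by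
  refine Integrable.of_bound (C := 1) (measurable_subtype_coe.comp hf).aestronglyMeasurable ?_
  refine Filter.Eventually.of_forall fun a => ?_
  rw [Real.norm_eq_abs, abs_of_nonneg (f a).2.1]
  exact (f a).2.2

theorem integrable_coe (μ : Measure I) [IsFiniteMeasure μ] : Integrable (fun ω : I => (ω : ℝ)) μ :=
  integrable_coe_comp μ measurable_id

theorem integral_cdf_eq (μ : Measure I) [IsProbabilityMeasure μ] (x : I) :
    ∫ s in Iic x, μ.real (Iic s) = ∫ ω, max ((x : ℝ) - ω) 0 ∂μ := by
  have hS : MeasurableSet {p : I × I | p.2 ≤ p.1} := measurableSet_le measurable_snd measurable_fst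
  have h1 := Measure.prod_apply (μ := (volume : Measure I).restrict (Iic x)) (ν := μ) hS
  have h2 := Measure.prod_apply_symm (μ := (volume : Measure I).restrict (Iic x)) (ν := μ) hS
  have h3 : ∀ ω : I, ((volume : Measure I).restrict (Iic x)) ((fun s => (s, ω)) ⁻¹' {p : I × I | p.2 ≤ p.1})
      = ENNReal.ofReal (max ((x : ℝ) - ω) 0) := fun ω => by
    have : (fun s => (s, ω)) ⁻¹' {p : I × I | p.2 ≤ p.1} = Ici ω := rfl
    rw [this, Measure.restrict_apply measurableSet_Ici, Ici_inter_Iic, unitInterval.volume_Icc]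
    simp
  simp only [h3] at h2
  rw [integral_eq_lintegral_of_nonneg_ae, integral_eq_lintegral_of_nonneg_ae, ← h2, h1]
  · congr 1
    refine lintegral_congr fun s => ?_
    exact ENNReal.ofReal_toReal (measure_ne_top _ _)
  · exact Filter.Eventually.of_forall fun ω => le_max_right _ _
  · fun_prop
  · exact Filter.Eventually.of_forall fun ω => measureReal_nonneg
  · refine Measurable.aestronglyMeasurable (Monotone.measurable fun s t h => ?_)
    exact measureReal_mono (Iic_subset_Iic.2 h)

theorem isMPC_iff (F G : ProbabilityMeasure I) : IsMPC F G ↔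
    (∀ x : I, ∫ ω, max ((x : ℝ) - ω) 0 ∂(G : Measure I) ≤
      ∫ ω, max ((x : ℝ) - ω) 0 ∂(F : Measure I)) ∧
    ∫ ω, (ω : ℝ) ∂(G : Measure I) = ∫ ω, (ω : ℝ) ∂(F : Measure I) := by
  have huniv : ∀ μ : Measure I, IsProbabilityMeasure μ →
      ∫ s : I, μ.real (Iic s) = 1 - ∫ ω, (ω : ℝ) ∂μ := fun μ _ => by
    have h := integral_cdf_eq μ 1
    have h1 : Iic (1 : I) = univ := eq_univ_of_forall fun x => x.2.2
    rw [h1, setIntegral_univ] at h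
    rw [h, integral_congr_ae (g := fun ω : I => (1 : ℝ) - ω)
      (Filter.Eventually.of_forall fun ω => by simp [ω.2.2]),
      integral_sub (integrable_const _) (integrable_coe μ)]
    simp
  unfold IsMPC
  simp only [integral_cdf_eq]
  rw [huniv _ inferInstance, huniv _ inferInstance]
  refine and_congr_right fun _ => ?_
  constructor <;> intro h <;> linarith

theorem integral_comp_quantile (μ : Measure I) [IsProbabilityMeasure μ] {h : I → ℝ}
    (hh : Measurable h) : ∫ u : I, h (quantile μ u) = ∫ ω, h ω ∂μ := by
  conv_rhs => rw [← map_quantile μ]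
  rw [integral_map (measurable_quantile μ).aemeasurable hh.aestronglyMeasurable]

theorem IsMPC.setIntegral_quantile_le {F G : ProbabilityMeasure I} (h : IsMPC F G) (t : I) :
    ∫ u in Iic t, (quantile F u : ℝ) ≤ ∫ u in Iic t, (quantile G u : ℝ) := by
  obtain ⟨h1, -⟩ := (isMPC_iff F G).1 h
  set x := quantile F t
  have hint : ∀ μ : Measure I, IsProbabilityMeasure μ → Integrable (fun u => (x : ℝ) - quantile μ u) :=
    fun μ _ => (integrable_const _).sub (integrable_coe_comp _ (measurable_quantile μ))
  have hintm : ∀ μ : Measure I, IsProbabilityMeasure μ →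
      Integrable (fun u => max ((x : ℝ) - quantile μ u) 0) :=
    fun μ hμ => (hint μ hμ).sup (integrable_const 0)
  have hF : ∫ u in Iic t, ((x : ℝ) - quantile F u) = ∫ ω, max ((x : ℝ) - ω) 0 ∂(F : Measure I) := by
    rw [← integral_comp_quantile (F : Measure I) (h := fun ω => max ((x : ℝ) - ω) 0) (by fun_prop),
      ← integral_indicator measurableSet_Iic]
    refine integral_congr_ae (Filter.Eventually.of_forall fun u => ?_)
    simp only [indicator, mem_Iic]
    split_ifs with hu
    · exact (max_eq_left (sub_nonneg.2 (Subtype.coe_le_coe.2 (monotone_quantile _ hu)))).symm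
    · exact (max_eq_right (sub_nonpos.2 (Subtype.coe_le_coe.2
        (monotone_quantile _ (not_le.1 hu).le)))).symm
  have hG : ∫ u in Iic t, ((x : ℝ) - quantile G u) ≤ ∫ ω, max ((x : ℝ) - ω) 0 ∂(G : Measure I) := by
    rw [← integral_comp_quantile (G : Measure I) (h := fun ω => max ((x : ℝ) - ω) 0) (by fun_prop)]
    refine (integral_mono (hint _ inferInstance).integrableOn (hintm _ inferInstance).integrableOn
      fun u => le_max_left _ _).trans ?_
    exact setIntegral_le_integral (hintm _ inferInstance)
      (Filter.Eventually.of_forall fun u => le_max_right _ _)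
  have hx := h1 x
  have key := hG.trans (hx.trans hF.symm.le)
  rw [integral_sub (integrable_const _) (integrable_coe_comp _ (measurable_quantile _)),
    integral_sub (integrable_const _) (integrable_coe_comp _ (measurable_quantile _))] at key
  linarith

theorem IsMPC.integral_quantile_eq {F G : ProbabilityMeasure I} (h : IsMPC F G) :
    ∫ u : I, (quantile F u : ℝ) = ∫ u : I, (quantile G u : ℝ) := by
  rw [integral_comp_quantile (F : Measure I) measurable_subtype_coe,
    integral_comp_quantile (G : Measure I) measurable_subtype_coe]
  exact ((isMPC_iff F G).1 h).2.symm

/-- Triples `(a, x, b)` for which `x` is the mean of a law on `{a, b}` with full support. -/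
def splitDomain : Set (I × I × I) :=
  {t | (t.1 < t.2.1 ∧ t.2.1 < t.2.2) ∨ (t.1 = t.2.1 ∧ t.2.1 = t.2.2)}

theorem measurableSet_splitDomain : MeasurableSet splitDomain := by
  have ha : Measurable fun t : I × I × I => t.1 := by fun_prop
  have hx : Measurable fun t : I × I × I => t.2.1 := by fun_prop
  have hb : Measurable fun t : I × I × I => t.2.2 := by fun_prop
  exact ((measurableSet_lt ha hx).inter (measurableSet_lt hx hb)).union
    ((measurableSet_eq_fun ha hx).inter (measurableSet_eq_fun hx hb))

/-- The weight of `a` in the law on `{a, b}` with mean `x`. -/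
noncomputable def splitWeight (t : I × I × I) : ENNReal :=
  min 1 (ENNReal.ofReal (((t.2.2 : ℝ) - t.2.1) / ((t.2.2 : ℝ) - t.1)))

@[fun_prop]
theorem measurable_splitWeight : Measurable splitWeight := by
  unfold splitWeight
  fun_prop

/-- The kernel sending `(a, x, b)` to the law on `{a, b}` with mean `x`. -/
noncomputable def splitKernel : Kernel (I × I × I) I where
  toFun t := splitWeight t • Measure.dirac t.1 + (1 - splitWeight t) • Measure.dirac t.2.2
  measurable' := by
    refine Measure.measurable_of_measurable_coe _ fun s hs => ?_
    simp only [Measure.coe_add, Measure.coe_smul, Pi.add_apply, Pi.smul_apply, smul_eq_mul,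
      Measure.dirac_apply' _ hs]
    have h1 : Measurable (s.indicator (1 : I → ENNReal)) := measurable_one.indicator hs
    fun_prop

theorem splitKernel_apply (t : I × I × I) : splitKernel t =
    splitWeight t • Measure.dirac t.1 + (1 - splitWeight t) • Measure.dirac t.2.2 := rfl

instance : IsMarkovKernel splitKernel := ⟨fun t => ⟨by
  simp [splitKernel_apply, splitWeight]⟩⟩

theorem splitWeight_eq {t : I × I × I} (h1 : t.1 < t.2.1) (h2 : t.2.1 < t.2.2) :
    splitWeight t = ENNReal.ofReal (((t.2.2 : ℝ) - t.2.1) / ((t.2.2 : ℝ) - t.1)) := by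
  have h1' : (t.1 : ℝ) < t.2.1 := h1
  have h2' : (t.2.1 : ℝ) < t.2.2 := h2
  refine min_eq_right ?_
  rw [← ENNReal.ofReal_one]
  exact ENNReal.ofReal_le_ofReal ((div_le_one (by linarith)).2 (by linarith))

theorem one_sub_splitWeight_eq {t : I × I × I} (h1 : t.1 < t.2.1) (h2 : t.2.1 < t.2.2) :
    1 - splitWeight t = ENNReal.ofReal (((t.2.1 : ℝ) - t.1) / ((t.2.2 : ℝ) - t.1)) := by
  have h1' : (t.1 : ℝ) < t.2.1 := h1
  have h2' : (t.2.1 : ℝ) < t.2.2 := h2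
  rw [splitWeight_eq h1 h2, ← ENNReal.ofReal_one, ← ENNReal.ofReal_sub _ (by
    apply div_nonneg <;> linarith)]
  congr 1
  have : (t.2.2 : ℝ) - t.1 ≠ 0 := by linarith
  field_simp
  ring

theorem splitKernel_apply_diag (x : I) : splitKernel (x, x, x) = Measure.dirac x := by
  rw [splitKernel_apply, ← add_smul]
  simp [splitWeight]

theorem integral_splitKernel {t : I × I × I} (ht : t ∈ splitDomain) :
    ∫ ω, (ω : ℝ) ∂(splitKernel t) = t.2.1 := by
  obtain ⟨a, x, b⟩ := t
  rcases ht with ⟨h1, h2⟩ | ⟨h1, h2⟩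
  · rw [splitKernel_apply, one_sub_splitWeight_eq h1 h2, splitWeight_eq h1 h2,
      integral_add_measure, integral_smul_measure, integral_smul_measure, integral_dirac,
      integral_dirac]
    · have h1' : (a : ℝ) < x := h1
      have h2' : (x : ℝ) < b := h2
      have h3 : (b : ℝ) - a ≠ 0 := by linarith
      simp only [smul_eq_mul]
      rw [ENNReal.toReal_ofReal (by apply div_nonneg <;> linarith),
        ENNReal.toReal_ofReal (by apply div_nonneg <;> linarith)]
      field_simp
      ring
    · exact (integrable_coe _).smul_measure ENNReal.ofReal_ne_top
    · exact (integrable_coe _).smul_measure ENNReal.ofReal_ne_top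
  · simp only at h1 h2
    subst h1 h2
    simp [splitKernel_apply_diag]

theorem ae_splitKernel (t : I × I × I) : ∀ᵐ ω ∂(splitKernel t), ω = t.1 ∨ ω = t.2.2 := by
  have hm : MeasurableSet {ω : I | ω = t.1 ∨ ω = t.2.2} :=
    (measurableSet_singleton t.1).union (measurableSet_singleton t.2.2)
  rw [splitKernel_apply, ae_add_measure_iff]
  exact ⟨Measure.ae_smul_measure ((ae_dirac_iff hm).2 (.inl rfl)) _,
    Measure.ae_smul_measure ((ae_dirac_iff hm).2 (.inr rfl)) _⟩

/-- Strassen's theorem on `[0,1]`, with conditional laws refined to two-point laws. -/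
theorem IsMPC.exists_splitting {F G : ProbabilityMeasure I} (h : IsMPC F G) :
    ∃ θ : Measure (I × I × I), IsProbabilityMeasure θ ∧ (∀ᵐ t ∂θ, t ∈ splitDomain) ∧
      θ.map (fun t => t.2.1) = G ∧ θ.bind splitKernel = F := by
  set f : I → I := quantile F with hf
  set g : I → I := quantile G with hg
  have hfm : Measurable f := measurable_quantile _
  have hgm : Measurable g := measurable_quantile _
  have hfi : Integrable (fun u => (f u : ℝ)) := integrable_coe_comp _ hfm
  have hgi : Integrable (fun u => (g u : ℝ)) := integrable_coe_comp _ hgm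
  set P : Measure I := volume.withDensity fun u => ENNReal.ofReal ((g u : ℝ) - f u) with hP
  set N : Measure I := volume.withDensity fun u => ENNReal.ofReal ((f u : ℝ) - g u) with hN
  have hPfin : IsFiniteMeasure P := isFiniteMeasure_withDensity_ofReal (hgi.sub hfi).2
  have hNfin : IsFiniteMeasure N := isFiniteMeasure_withDensity_ofReal (hfi.sub hgi).2
  have hdiff : ∀ s : Set I, MeasurableSet s → (P s).toReal - (N s).toReal =
      (∫ u in s, (g u : ℝ)) - ∫ u in s, (f u : ℝ) := fun s hs => by
    rw [← integral_sub hgi.integrableOn hfi.integrableOn,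
      integral_eq_lintegral_pos_part_sub_lintegral_neg_part (f := fun u => (g u : ℝ) - f u)
        (hgi.sub hfi).integrableOn,
      hP, hN, withDensity_apply _ hs, withDensity_apply _ hs]
    simp
  have hdom : ∀ t, N (Iic t) ≤ P (Iic t) := fun t => by
    rw [← ENNReal.toReal_le_toReal (measure_ne_top _ _) (measure_ne_top _ _)]
    have := hdiff (Iic t) measurableSet_Iic
    have := h.setIntegral_quantile_le t
    linarith
  have huniv : P univ = N univ := by
    rw [← ENNReal.toReal_eq_toReal_iff' (measure_ne_top _ _) (measure_ne_top _ _)]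
    have h1 := hdiff univ MeasurableSet.univ
    have := h.integral_quantile_eq
    rw [setIntegral_univ, setIntegral_univ] at h1
    linarith
  obtain ⟨κ, hκfin, hκ1, hκ2, hκle⟩ := exists_ordered_coupling P N huniv hdom
  have hlt1 : ∀ᵐ z ∂κ, f z.1 < g z.1 := by
    have : ∀ᵐ u ∂P, f u < g u := by
      rw [hP, ae_withDensity_iff (by fun_prop)]
      refine Filter.Eventually.of_forall fun u hu => ?_
      simpa using hu
    rw [← hκ1] at this
    exact ae_of_ae_map measurable_fst.aemeasurable this
  have hlt2 : ∀ᵐ z ∂κ, g z.2 < f z.2 := by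
    have : ∀ᵐ u ∂N, g u < f u := by
      rw [hN, ae_withDensity_iff (by fun_prop)]
      refine Filter.Eventually.of_forall fun u hu => ?_
      simpa using hu
    rw [← hκ2] at this
    exact ae_of_ae_map measurable_snd.aemeasurable this
  have hchain : ∀ᵐ z ∂κ, f z.1 < g z.1 ∧ g z.1 < f z.2 ∧ f z.1 < g z.2 ∧ g z.2 < f z.2 := by
    filter_upwards [hlt1, hlt2, hκle] with z h1 h2 h3
    have : g z.1 ≤ g z.2 := monotone_quantile _ h3
    exact ⟨h1, this.trans_lt h2, h1.trans_le this, h2⟩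
  set d1 : I × I → ENNReal := fun z => ENNReal.ofReal (1 / ((g z.1 : ℝ) - f z.1)) with hd1
  set d2 : I × I → ENNReal := fun z => ENNReal.ofReal (1 / ((f z.2 : ℝ) - g z.2)) with hd2
  have hd1m : Measurable d1 := by fun_prop
  have hd2m : Measurable d2 := by fun_prop
  have hmarg : ∀ (p q : I → I) (m : Measure I) (φ : I → ENNReal), Measurable p → Measurable q →
      m = volume.withDensity (fun u => ENNReal.ofReal ((p u : ℝ) - q u)) → Measurable φ →
      ∫⁻ u, ENNReal.ofReal (1 / ((p u : ℝ) - q u)) * φ u ∂m = ∫⁻ u in {u | q u < p u}, φ u := by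
    intro p q m φ hp hq hm hφ
    rw [hm, lintegral_withDensity_eq_lintegral_mul _ (by fun_prop) (by fun_prop),
      ← lintegral_indicator (measurableSet_lt hq hp)]
    refine lintegral_congr fun u => ?_
    simp only [Pi.mul_apply, indicator, mem_ofPred_eq]
    split_ifs with hu
    · have hu' : (0 : ℝ) < (p u : ℝ) - q u := sub_pos.2 hu
      rw [← mul_assoc, ← ENNReal.ofReal_mul hu'.le, mul_one_div_cancel hu'.ne']
      simp
    · have hu' : (p u : ℝ) - q u ≤ 0 := sub_nonpos.2 (not_lt.1 hu)
      simp [ENNReal.ofReal_of_nonpos hu']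
  have hm1 : ∀ φ : I → ENNReal, Measurable φ →
      ∫⁻ z, d1 z * φ z.1 ∂κ = ∫⁻ u in {u | f u < g u}, φ u := fun φ hφ => by
    rw [← hmarg g f P φ hgm hfm hP hφ, ← hκ1, lintegral_map (by fun_prop) measurable_fst]
  have hm2 : ∀ φ : I → ENNReal, Measurable φ →
      ∫⁻ z, d2 z * φ z.2 ∂κ = ∫⁻ u in {u | g u < f u}, φ u := fun φ hφ => by
    rw [← hmarg f g N φ hfm hgm hN hφ, ← hκ2, lintegral_map (by fun_prop) measurable_snd]
  have hsum : ∀ φ : I → ENNReal, Measurable φ →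
      (∫⁻ u in {u | f u < g u}, φ u) + (∫⁻ u in {u | g u < f u}, φ u) +
          (∫⁻ u in {u | f u = g u}, φ u)
        = ∫⁻ u, φ u := fun φ hφ => by
    have hA : MeasurableSet {u | f u < g u} := measurableSet_lt hfm hgm
    have hB : MeasurableSet {u | g u < f u} := measurableSet_lt hgm hfm
    have hC : MeasurableSet {u | f u = g u} := measurableSet_eq_fun hfm hgm
    have hAB : Disjoint {u | f u < g u} {u | g u < f u} :=
      disjoint_left.2 fun u (hu : f u < g u) (hu' : g u < f u) => lt_asymm hu hu'
    have hABC : Disjoint ({u | f u < g u} ∪ {u | g u < f u}) {u | f u = g u} := by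
      refine disjoint_left.2 fun u hu (hu' : f u = g u) => ?_
      rcases hu with (hu : f u < g u) | (hu : g u < f u)
      · exact hu.ne hu'
      · exact hu.ne' hu'
    rw [← lintegral_union hB hAB, ← lintegral_union hC hABC]
    have : {u | f u < g u} ∪ {u | g u < f u} ∪ {u | f u = g u} = univ := by
      ext u
      rcases lt_trichotomy (f u) (g u) with h | h | h <;> simp [h]
    rw [this, setLIntegral_univ]
  set e1 : I × I → I × I × I := fun z => (f z.1, g z.1, f z.2) with he1
  set e2 : I × I → I × I × I := fun z => (f z.1, g z.2, f z.2) with he2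
  set e3 : I → I × I × I := fun u => (f u, f u, f u) with he3
  have he1m : Measurable e1 := by fun_prop
  have he2m : Measurable e2 := by fun_prop
  have he3m : Measurable e3 := by fun_prop
  set θ : Measure (I × I × I) := (κ.withDensity d1).map e1 + (κ.withDensity d2).map e2 +
    ((volume : Measure I).restrict {u | f u = g u}).map e3 with hθ
  have hθint : ∀ ψ : I × I × I → ENNReal, Measurable ψ → ∫⁻ t, ψ t ∂θ =
      (∫⁻ z, d1 z * ψ (e1 z) ∂κ) + (∫⁻ z, d2 z * ψ (e2 z) ∂κ) +
        ∫⁻ u in {u | f u = g u}, ψ (e3 u) := fun ψ hψ => by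
    rw [hθ, lintegral_add_measure, lintegral_add_measure, lintegral_map hψ he1m,
      lintegral_map hψ he2m, lintegral_map hψ he3m,
      lintegral_withDensity_eq_lintegral_mul _ hd1m (by fun_prop),
      lintegral_withDensity_eq_lintegral_mul _ hd2m (by fun_prop)]
    rfl
  have hbind : θ.bind splitKernel = F := by
    ext A hA
    have hφ : Measurable (A.indicator (1 : I → ENNReal)) := measurable_one.indicator hA
    rw [Measure.bind_apply hA splitKernel.measurable.aemeasurable,
      hθint _ (splitKernel.measurable_coe hA)]
    have hpt : ∀ᵐ z ∂κ, d1 z * splitKernel (e1 z) A + d2 z * splitKernel (e2 z) A =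
        d1 z * A.indicator 1 (f z.1) + d2 z * A.indicator 1 (f z.2) := by
      filter_upwards [hchain] with z hz
      obtain ⟨h1, h2, h3, h4⟩ := hz
      rw [splitKernel_apply, splitKernel_apply,
        one_sub_splitWeight_eq (t := e1 z) h1 h2, splitWeight_eq (t := e1 z) h1 h2,
        one_sub_splitWeight_eq (t := e2 z) h3 h4, splitWeight_eq (t := e2 z) h3 h4]
      simp only [Measure.coe_add, Measure.coe_smul, Pi.add_apply, Pi.smul_apply, smul_eq_mul,
        Measure.dirac_apply' _ hA, he1, he2, hd1, hd2]
      have h1' : (0 : ℝ) < (g z.1 : ℝ) - f z.1 := sub_pos.2 h1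
      have h2' : (0 : ℝ) < (f z.2 : ℝ) - g z.1 := sub_pos.2 h2
      have h3' : (0 : ℝ) < (g z.2 : ℝ) - f z.1 := sub_pos.2 h3
      have h4' : (0 : ℝ) < (f z.2 : ℝ) - g z.2 := sub_pos.2 h4
      have h5' : (0 : ℝ) < (f z.2 : ℝ) - f z.1 := by linarith
      have ha : ENNReal.ofReal (1 / ((g z.1 : ℝ) - f z.1)) *
            ENNReal.ofReal (((f z.2 : ℝ) - g z.1) / ((f z.2 : ℝ) - f z.1)) +
          ENNReal.ofReal (1 / ((f z.2 : ℝ) - g z.2)) *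
            ENNReal.ofReal (((f z.2 : ℝ) - g z.2) / ((f z.2 : ℝ) - f z.1)) =
          ENNReal.ofReal (1 / ((g z.1 : ℝ) - f z.1)) := by
        rw [← ENNReal.ofReal_mul (by positivity), ← ENNReal.ofReal_mul (by positivity),
          ← ENNReal.ofReal_add (by positivity) (by positivity)]
        congr 1
        field_simp
        ring
      have hb : ENNReal.ofReal (1 / ((g z.1 : ℝ) - f z.1)) *
            ENNReal.ofReal (((g z.1 : ℝ) - f z.1) / ((f z.2 : ℝ) - f z.1)) +
          ENNReal.ofReal (1 / ((f z.2 : ℝ) - g z.2)) *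
            ENNReal.ofReal (((g z.2 : ℝ) - f z.1) / ((f z.2 : ℝ) - f z.1)) =
          ENNReal.ofReal (1 / ((f z.2 : ℝ) - g z.2)) := by
        rw [← ENNReal.ofReal_mul (by positivity), ← ENNReal.ofReal_mul (by positivity),
          ← ENNReal.ofReal_add (by positivity) (by positivity)]
        congr 1
        field_simp
        ring
      rw [mul_add, mul_add, ← mul_assoc, ← mul_assoc, ← mul_assoc, ← mul_assoc,
        add_add_add_comm, ← add_mul, ← add_mul, ha, hb]
    rw [← lintegral_add_left (by
      exact hd1m.mul ((splitKernel.measurable_coe hA).comp he1m)), lintegral_congr_ae hpt,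
      lintegral_add_left (by fun_prop), hm1 (fun u => A.indicator 1 (f u)) (by fun_prop),
      hm2 (fun u => A.indicator 1 (f u)) (by fun_prop)]
    simp only [he3, splitKernel_apply_diag, Measure.dirac_apply' _ hA]
    rw [hsum _ (by fun_prop), ← lintegral_map hφ hfm, hf, map_quantile]
    simp [lintegral_indicator hA]
  refine ⟨θ, ⟨?_⟩, ?_, ?_, hbind⟩
  · have := congrArg (fun m : Measure I => m univ) hbind
    simpa [Measure.bind_apply MeasurableSet.univ splitKernel.measurable.aemeasurable] using this
  · rw [hθ, ae_add_measure_iff, ae_add_measure_iff,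
      ae_map_iff (p := (· ∈ splitDomain)) he1m.aemeasurable measurableSet_splitDomain,
      ae_map_iff (p := (· ∈ splitDomain)) he2m.aemeasurable measurableSet_splitDomain,
      ae_map_iff (p := (· ∈ splitDomain)) he3m.aemeasurable measurableSet_splitDomain]
    refine ⟨⟨?_, ?_⟩, Filter.Eventually.of_forall fun u => .inr ⟨rfl, rfl⟩⟩
    · exact (withDensity_absolutelyContinuous κ d1).ae_le
        (hchain.mono fun z hz => .inl ⟨hz.1, hz.2.1⟩)
    · exact (withDensity_absolutelyContinuous κ d2).ae_le
        (hchain.mono fun z hz => .inl ⟨hz.2.2.1, hz.2.2.2⟩)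
  · ext A hA
    have hφ : Measurable (A.indicator (1 : I → ENNReal)) := measurable_one.indicator hA
    have hxm : Measurable fun t : I × I × I => t.2.1 := by fun_prop
    have h1 : θ.map (fun t => t.2.1) A = ∫⁻ t, A.indicator 1 t.2.1 ∂θ := by
      rw [← lintegral_map hφ hxm, lintegral_indicator hA]
      simp
    rw [h1, hθint _ (by fun_prop), hm1 (fun u => A.indicator 1 (g u)) (by fun_prop),
      hm2 (fun u => A.indicator 1 (g u)) (by fun_prop)]
    have h3 : ∫⁻ u in {u | f u = g u}, A.indicator (1 : I → ENNReal) (e3 u).2.1 =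
        ∫⁻ u in {u | f u = g u}, A.indicator (1 : I → ENNReal) (g u) :=
      setLIntegral_congr_fun (measurableSet_eq_fun hfm hgm) fun u hu => by
        simp only [he3]; rw [show f u = g u from hu]
    rw [h3, hsum _ (by fun_prop), ← lintegral_map hφ hgm, hg, map_quantile]
    simp [lintegral_indicator hA]

/-- The message `{a, x, b}`. -/
def tripleMessage (t : I × I × I) : Message := {t.1} ⊔ {t.2.1} ⊔ {t.2.2}

theorem mem_tripleMessage {t : I × I × I} {ω : I} :
    ω ∈ tripleMessage t ↔ ω = t.1 ∨ ω = t.2.1 ∨ ω = t.2.2 := by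
  simp only [tripleMessage, ← SetLike.mem_coe, NonemptyCompacts.coe_sup,
    NonemptyCompacts.coe_singleton, mem_union, mem_singleton_iff, or_assoc]

theorem measurable_tripleMessage : Measurable tripleMessage := by
  refine Continuous.measurable ?_
  have h : Continuous fun x : I => ({x} : Message) :=
    NonemptyCompacts.isEmbedding_singleton.continuous
  exact ((h.comp continuous_fst).sup (h.comp (continuous_fst.comp continuous_snd))).sup
    (h.comp (continuous_snd.comp continuous_snd))

theorem le_of_mem_splitDomain {t : I × I × I} (ht : t ∈ splitDomain) :
    t.1 ≤ t.2.1 ∧ t.2.1 ≤ t.2.2 := by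
  rcases ht with h | h
  · exact ⟨h.1.le, h.2.le⟩
  · exact ⟨h.1.le, h.2.le⟩

theorem injOn_tripleMessage : InjOn tripleMessage splitDomain := by
  intro t ht t' ht' h
  have hmem : ∀ ω, (ω = t.1 ∨ ω = t.2.1 ∨ ω = t.2.2) ↔ (ω = t'.1 ∨ ω = t'.2.1 ∨ ω = t'.2.2) :=
    fun ω => by rw [← mem_tripleMessage, ← mem_tripleMessage, h]
  obtain ⟨a, x, b⟩ := t
  obtain ⟨a', x', b'⟩ := t'
  have h1 := le_of_mem_splitDomain ht
  have h2 := le_of_mem_splitDomain ht'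
  simp only [splitDomain, mem_ofPred_eq] at ht ht' hmem h1 h2
  have ha : a = a' := le_antisymm
    (by rcases (hmem a').2 (.inl rfl) with h | h | h <;> order)
    (by rcases (hmem a).1 (.inl rfl) with h | h | h <;> order)
  have hb : b = b' := le_antisymm
    (by rcases (hmem b).1 (.inr (.inr rfl)) with h | h | h <;> order)
    (by rcases (hmem b').2 (.inr (.inr rfl)) with h | h | h <;> order)
  subst ha hb
  have hx : x = x' := by
    rcases ht with h | h
    · rcases (hmem x).1 (.inr (.inl rfl)) with h' | h' | h' <;> order
    · order
  rw [hx]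

/-- Triple messages can be decoded in a measurable way. -/
theorem exists_decoder : MeasurableSet (tripleMessage '' splitDomain) ∧
    ∃ dec : Message → I × I × I, Measurable dec ∧ ∀ t ∈ splitDomain, dec (tripleMessage t) = t := by
  have : StandardBorelSpace splitDomain := measurableSet_splitDomain.standardBorel
  have hemb : MeasurableEmbedding fun t : splitDomain => tripleMessage t :=
    (measurable_tripleMessage.comp measurable_subtype_coe).measurableEmbedding
      (injOn_iff_injective.1 injOn_tripleMessage)
  refine ⟨measurableSet_splitDomain.image_of_measurable_injOn measurable_tripleMessage
    injOn_tripleMessage, ?_⟩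
  obtain ⟨dec, hdec, hcomp⟩ := hemb.exists_measurable_extend (g := fun t : splitDomain => t.1)
    measurable_subtype_coe (fun _ => inferInstance)
  exact ⟨dec, hdec, fun t ht => congrFun hcomp ⟨t, ht⟩⟩

/-- The highest state in a message. -/
noncomputable def highest (m : Message) : I := sSup (m : Set I)

/-- The lowest state in a message. -/
noncomputable def lowest (m : Message) : I := sInf (m : Set I)

theorem highest_mem (m : Message) : highest m ∈ m := m.isCompact.sSup_mem m.nonempty

theorem lowest_mem (m : Message) : lowest m ∈ m := m.isCompact.sInf_mem m.nonempty

theorem le_highest {m : Message} {ω : I} (h : ω ∈ m) : ω ≤ highest m := le_sSup h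

theorem lowest_le {m : Message} {ω : I} (h : ω ∈ m) : lowest m ≤ ω := sInf_le h

theorem isClosed_le_highest (c : I) : IsClosed {m : Message | c ≤ highest m} := by
  have : {m : Message | c ≤ highest m} = {m : Message | ((m : Set I) ∩ Ici c).Nonempty} := by
    ext m
    exact ⟨fun h => ⟨_, highest_mem m, h⟩, fun ⟨ω, hω, hc⟩ => le_trans hc (le_highest hω)⟩
  rw [this]
  exact NonemptyCompacts.isClosed_inter_nonempty_of_isClosed isClosed_Ici

theorem isClosed_lowest_le (c : I) : IsClosed {m : Message | lowest m ≤ c} := by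
  have : {m : Message | lowest m ≤ c} = {m : Message | ((m : Set I) ∩ Iic c).Nonempty} := by
    ext m
    exact ⟨fun h => ⟨_, lowest_mem m, h⟩, fun ⟨ω, hω, hc⟩ => le_trans (lowest_le hω) hc⟩
  rw [this]
  exact NonemptyCompacts.isClosed_inter_nonempty_of_isClosed isClosed_Iic

theorem measurable_highest : Measurable highest :=
  measurable_of_Ici fun c => (isClosed_le_highest c).measurableSet

theorem measurable_lowest : Measurable lowest :=
  measurable_of_Iic fun c => (isClosed_lowest_le c).measurableSet

theorem isClosed_mem : IsClosed {z : I × Message | z.1 ∈ z.2} := by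
  have h : Continuous fun z : I × Message => (({z.1} : Message), z.2) :=
    (NonemptyCompacts.isEmbedding_singleton.continuous.comp continuous_fst).prodMk continuous_snd
  have : {z : I × Message | z.1 ∈ z.2} =
      ((fun z : I × Message => (({z.1} : Message), z.2)) ⁻¹'
        {p | Disjoint (p.1 : Set I) (p.2 : Set I)})ᶜ := by
    ext z
    simp
  rw [this]
  exact (NonemptyCompacts.isOpen_setOfPred_disjoint_coe.preimage h).isClosed_compl

theorem isClosed_mem_right (ω : I) : IsClosed {m : Message | ω ∈ m} :=
  isClosed_mem.preimage (Continuous.prodMk_right ω)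

theorem measurable_mean {α : Type*} [MeasurableSpace α] (p : Kernel α I) [IsMarkovKernel p] :
    Measurable fun a => mean (p a) := by
  refine Measurable.subtype_mk ?_
  exact (StronglyMeasurable.integral_kernel
    (f := fun ω : I => (ω : ℝ)) measurable_subtype_coe.stronglyMeasurable).measurable

/-- A law of messages together with posteriors comes from a sender's strategy that respects a
given correspondence in every state. -/
theorem exists_sender (F : Measure I) [IsProbabilityMeasure F] (Λ : Measure Message)
    [IsProbabilityMeasure Λ] (p : Kernel Message I) [IsMarkovKernel p] (hF : Λ.bind p = F)
    {R : Set (I × Message)} (hR : MeasurableSet R) (hae : ∀ᵐ m ∂Λ, ∀ᵐ ω ∂(p m), (ω, m) ∈ R)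
    {s : I → Message} (hs : Measurable s) (hsR : ∀ ω, (ω, s ω) ∈ R) :
    ∃ η : Kernel I Message, IsMarkovKernel η ∧ (∀ ω, ∀ᵐ m ∂(η ω), (ω, m) ∈ R) ∧
      ∀ (A : Set I) (B : Set Message), MeasurableSet A → MeasurableSet B →
        ∫⁻ ω in A, η ω B ∂F = ∫⁻ m in B, p m A ∂Λ := by
  classical
  set ρ : Measure (I × Message) := (Λ ⊗ₘ p).map Prod.swap with hρ
  have hρprob : IsProbabilityMeasure ρ :=
    Measure.isProbabilityMeasure_map measurable_swap.aemeasurable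
  have hfst : ρ.fst = F := by
    rw [hρ, Measure.fst_map_swap, Measure.snd_compProd, hF]
  have hdis : F ⊗ₘ ρ.condKernel = ρ := by
    rw [← hfst]
    exact ρ.disintegrate ρ.condKernel
  have hρR : ∀ᵐ z ∂ρ, z ∈ R := by
    rw [hρ, ae_map_iff (p := (· ∈ R)) measurable_swap.aemeasurable hR]
    exact (Measure.ae_compProd_iff (measurable_swap hR)).2 hae
  have hgood : ∀ᵐ ω ∂F, ∀ᵐ m ∂(ρ.condKernel ω), (ω, m) ∈ R := by
    rw [← hdis] at hρR
    exact (Measure.ae_compProd_iff hR).1 hρR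
  have hDm : MeasurableSet {ω : I | ρ.condKernel ω (Prod.mk ω ⁻¹' Rᶜ) = 0} :=
    (Kernel.measurable_kernel_prodMk_left hR.compl) (measurableSet_singleton 0)
  refine ⟨Kernel.piecewise hDm ρ.condKernel (Kernel.deterministic s hs), inferInstance, ?_, ?_⟩
  · intro ω
    rw [Kernel.piecewise_apply]
    split_ifs with hω
    · exact hω
    · rw [Kernel.deterministic_apply]
      exact (ae_dirac_iff (measurable_prodMk_left hR)).2 (hsR ω)
  · intro A B hA hB
    have h1 : ∫⁻ ω in A, Kernel.piecewise hDm ρ.condKernel (Kernel.deterministic s hs) ω B ∂F =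
        ∫⁻ ω in A, ρ.condKernel ω B ∂F := by
      refine lintegral_congr_ae (ae_restrict_of_ae ?_)
      filter_upwards [hgood] with ω hω
      rw [Kernel.piecewise_apply, if_pos]
      exact hω
    rw [h1, ← Measure.compProd_apply_prod hA hB, hdis, hρ,
      Measure.map_apply measurable_swap (hA.prod hB), preimage_swap_prod,
      Measure.compProd_apply_prod hB hA]

namespace Environment

variable (E : Environment 2)

theorem valueFn_eq (x : I) : E.valueFn x = if E.cutoff 1 ≤ x then E.v 1 else 0 := by
  have h0 : E.v 0 = 0 := E.v_zero 0 rfl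
  have hv : E.v 0 < E.v 1 := E.v_strictMono Fin.zero_lt_one
  split_ifs with h
  · refine IsGreatest.csSup_eq ⟨⟨1, ⟨h, ?_⟩, rfl⟩, ?_⟩
    · exact (show x ≤ 1 from x.2.2).trans E.cutoff_last.ge
    · rintro _ ⟨i, -, rfl⟩
      exact E.v_strictMono.monotone (Fin.le_last i)
  · refine IsGreatest.csSup_eq ⟨⟨0, ⟨?_, (not_le.1 h).le⟩, h0⟩, ?_⟩
    · exact E.cutoff_zero.le.trans x.2.1
    · rintro _ ⟨i, hi, rfl⟩
      fin_cases i
      · exact h0.le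
      · exact absurd hi.1 h

theorem v_one_pos : 0 < E.v 1 := by
  rw [← E.v_zero 0 rfl]
  exact E.v_strictMono Fin.zero_lt_one

theorem integral_valueFn (G : Measure I) [IsProbabilityMeasure G] :
    ∫ x, E.valueFn x ∂G = G.real (Ici (E.cutoff 1)) * E.v 1 := by
  have : E.valueFn = (Ici (E.cutoff 1)).indicator fun _ => E.v 1 := by
    ext x
    simp [valueFn_eq, indicator]
  rw [this, integral_indicator measurableSet_Ici]
  simp

theorem IsOptimalSignal.commitmentPayoff_eq {E : Environment 2} {G : ProbabilityMeasure I}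
    (hG : E.IsOptimalSignal G) : E.commitmentPayoff = ∫ x, E.valueFn x ∂(G : Measure I) := by
  refine IsGreatest.csSup_eq ⟨⟨G, hG.1, rfl⟩, ?_⟩
  rintro _ ⟨G', hG', rfl⟩
  exact hG.2 G' hG'

/-- Sufficient conditions for an outcome in which the receiver answers the messages in `W` by the
high action and all others by the low action, and the messages available to the sender in state
`ω` are given by the section of `R` at `ω`. -/
theorem isEquilibriumOutcome_of_messageLaw {E : Environment 2} {G : ProbabilityMeasure I}
    (hG : E.IsOptimalSignal G) (Λ : Measure Message) [IsProbabilityMeasure Λ]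
    (p : Kernel Message I) [IsMarkovKernel p] (hF : Λ.bind p = E.prior)
    (hsupp : ∀ m, ∀ᵐ ω ∂(p m), ω ∈ m) (hout : Λ.map (fun m => mean (p m)) = G)
    {W : Set Message} (hW : MeasurableSet W)
    (hmeanW : ∀ m ∈ W, E.cutoff 1 ≤ mean (p m)) (hmeanW' : ∀ m ∉ W, mean (p m) ≤ E.cutoff 1)
    (hΛW : ∀ᵐ m ∂Λ, E.cutoff 1 ≤ mean (p m) → m ∈ W)
    {R : Set (I × Message)} (hR : MeasurableSet R) (hRclosed : ∀ ω, IsClosed {m | (ω, m) ∈ R})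
    (hRmem : ∀ ω m, (ω, m) ∈ R → ω ∈ m)
    (hRopt : ∀ ω m, (ω, m) ∈ R → m ∉ W → ∀ m' : Message, ω ∈ m' → m' ∉ W)
    (hae : ∀ᵐ m ∂Λ, ∀ᵐ ω ∂(p m), (ω, m) ∈ R)
    {s : I → Message} (hs : Measurable s) (hsR : ∀ ω, (ω, s ω) ∈ R) :
    E.IsEquilibriumOutcome G E.commitmentPayoff := by
  classical
  obtain ⟨η, hη, hηR, hbayes⟩ := exists_sender (E.prior : Measure I) Λ p hF hR hae hs hsR
  have hηsupp : ∀ ω, (η ω).support ⊆ {m | (ω, m) ∈ R} := fun ω =>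
    Measure.support_subset_of_isClosed (hRclosed ω) (hηR ω)
  have hτ : Measurable fun m : Message => if m ∈ W then (1 : Fin 2) else 0 :=
    Measurable.ite hW measurable_const measurable_const
  let A : Assessment 2 :=
    { sender := η
      receiver := Kernel.deterministic _ hτ
      belief := p
      sender_feasible := fun ω m hm => hRmem ω m (hηsupp ω hm) }
  have hlaw : E.messageLaw A = Λ := by
    ext B hB
    have h := hbayes univ B MeasurableSet.univ hB
    rw [messageLaw, Measure.bind_apply hB A.sender.measurable.aemeasurable]
    simpa using h
  have hpay : ∀ m, E.messagePayoff A m = if m ∈ W then E.v 1 else 0 := fun m => by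
    have h0 : E.v 0 = 0 := E.v_zero 0 rfl
    simp only [messagePayoff, A, Kernel.deterministic_apply, Fin.sum_univ_two, h0, mul_zero,
      zero_add]
    split_ifs <;> simp [Measure.real]
  refine ⟨A, ⟨?_, ?_, ?_, ?_⟩, ?_, ?_⟩
  · refine fun ω m hm => ⟨hRmem ω m (hηsupp ω hm), fun m' hm' => ?_⟩
    rw [hpay, hpay]
    have := E.v_one_pos
    by_cases hmW : m ∈ W
    · rw [if_pos hmW]
      split_ifs
      exacts [le_rfl, this.le]
    · rw [if_neg hmW, if_neg (hRopt ω m (hηsupp ω hm) hmW m' hm')]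
  · intro m i hi
    by_cases hm : m ∈ W
    · have : i = 1 := by
        by_contra hne
        simp [A, Kernel.deterministic_apply, hm, Ne.symm hne] at hi
      subst this
      exact ⟨hmeanW m hm, (show mean (p m) ≤ 1 from (mean (p m)).2.2).trans E.cutoff_last.ge⟩
    · have : i = 0 := by
        by_contra hne
        simp [A, Kernel.deterministic_apply, hm, Ne.symm hne] at hi
      subst this
      exact ⟨E.cutoff_zero.le.trans (mean (p m)).2.1, hmeanW' m hm⟩
  · exact fun ω m hω hsup => hω (Measure.support_subset_of_isClosed m.isCompact.isClosed
      (hsupp m) hsup)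
  · intro B C hB hC
    rw [hlaw]
    exact hbayes B C hB hC
  · rw [hlaw]
    exact hout.symm
  · rw [hlaw, hG.commitmentPayoff_eq, ← hout,
      integral_map (measurable_mean p).aemeasurable]
    · refine integral_congr_ae (hΛW.mono fun m hm => ?_)
      simp only
      rw [hpay, valueFn_eq]
      exact if_congr ⟨hm, hmeanW m⟩ rfl rfl
    · refine Measurable.aestronglyMeasurable ?_
      have : E.valueFn = fun x => if E.cutoff 1 ≤ x then E.v 1 else 0 := funext E.valueFn_eq
      rw [this]
      exact Measurable.ite measurableSet_Ici measurable_const measurable_const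

end Environment

theorem coe_mean (μ : Measure I) [IsProbabilityMeasure μ] :
    ((mean μ : I) : ℝ) = ∫ ω, (ω : ℝ) ∂μ := rfl

/-- There are beliefs that decode each triple message `{a, x, b}` with `(a, x, b) ∈ C` as the law
on `{a, b}` with mean `x`, and put all mass on a given selection after any other message. -/
theorem exists_belief {C : Set (I × I × I)} (hC : MeasurableSet C) {off : Message → I}
    (hoff : Measurable off) (hmem : ∀ m, off m ∈ m) :
    ∃ p : Kernel Message I, IsMarkovKernel p ∧ (∀ m, ∀ᵐ ω ∂(p m), ω ∈ m) ∧
      (∀ t ∈ splitDomain ∩ C, p (tripleMessage t) = splitKernel t) ∧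
      ∀ m, (∃ t ∈ splitDomain ∩ C, m = tripleMessage t) ∨ p m = Measure.dirac (off m) := by
  classical
  obtain ⟨hrange, dec, hdec, hleft⟩ := exists_decoder
  have hT : MeasurableSet (tripleMessage '' splitDomain ∩ dec ⁻¹' C) := hrange.inter (hdec hC)
  set p : Kernel Message I :=
    Kernel.piecewise hT (splitKernel.comap dec hdec) (Kernel.deterministic off hoff) with hp
  have hin : ∀ t ∈ splitDomain ∩ C, p (tripleMessage t) = splitKernel t := fun t ht => by
    rw [hp, Kernel.piecewise_apply, if_pos, Kernel.comap_apply, hleft t ht.1]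
    exact ⟨mem_image_of_mem _ ht.1, by rw [mem_preimage, hleft t ht.1]; exact ht.2⟩
  have hcases : ∀ m, (∃ t ∈ splitDomain ∩ C, m = tripleMessage t) ∨
      p m = Measure.dirac (off m) := fun m => by
    by_cases hm : m ∈ tripleMessage '' splitDomain ∩ dec ⁻¹' C
    · obtain ⟨⟨t, ht, rfl⟩, hC'⟩ := hm
      rw [mem_preimage, hleft t ht] at hC'
      exact .inl ⟨t, ⟨ht, hC'⟩, rfl⟩
    · rw [hp, Kernel.piecewise_apply, if_neg hm, Kernel.deterministic_apply]
      exact .inr rfl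
  refine ⟨p, inferInstance, fun m => ?_, hin, hcases⟩
  rcases hcases m with ⟨t, ht, rfl⟩ | h
  · rw [hin t ht]
    filter_upwards [ae_splitKernel t] with ω hω
    rw [mem_tripleMessage]
    tauto
  · rw [h]
    exact (ae_dirac_iff (isClosed_mem.measurableSet.preimage measurable_prodMk_right)).2 (hmem m)

theorem mean_eq_of_eq_splitKernel {μ : Measure I} [IsProbabilityMeasure μ] {t : I × I × I}
    (ht : t ∈ splitDomain) (h : μ = splitKernel t) : mean μ = t.2.1 := by
  refine Subtype.ext ?_
  rw [coe_mean, h, integral_splitKernel ht]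

theorem mean_eq_of_eq_dirac {μ : Measure I} [IsProbabilityMeasure μ] {x : I}
    (h : μ = Measure.dirac x) : mean μ = x := by
  refine Subtype.ext ?_
  rw [coe_mean, h, integral_dirac]

theorem bind_map_tripleMessage {θ : Measure (I × I × I)} {p : Kernel Message I}
    (h : ∀ᵐ t ∂θ, p (tripleMessage t) = splitKernel t) :
    (θ.map tripleMessage).bind p = θ.bind splitKernel := by
  ext A hA
  rw [Measure.bind_apply hA p.measurable.aemeasurable,
    lintegral_map (p.measurable_coe hA) measurable_tripleMessage,
    Measure.bind_apply hA splitKernel.measurable.aemeasurable]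
  exact lintegral_congr_ae (h.mono fun t ht => by simp only [ht])

theorem map_mean_map_tripleMessage {θ : Measure (I × I × I)} {p : Kernel Message I}
    [IsMarkovKernel p] (hθ : ∀ᵐ t ∂θ, t ∈ splitDomain)
    (h : ∀ᵐ t ∂θ, p (tripleMessage t) = splitKernel t) :
    (θ.map tripleMessage).map (fun m => mean (p m)) = θ.map fun t => t.2.1 := by
  rw [Measure.map_map (measurable_mean p) measurable_tripleMessage]
  refine Measure.map_congr ?_
  filter_upwards [hθ, h] with t ht hpt
  exact mean_eq_of_eq_splitKernel ht hpt

/-- Pooling the states in `D` at their mean is a mean-preserving contraction. -/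
theorem isMPC_pool (F : ProbabilityMeasure I) {D : Set I} (hD : MeasurableSet D) {c : I}
    (hc : ∫ ω in D, (ω : ℝ) ∂(F : Measure I) = (F : Measure I).real D * c)
    {g : I → I} (hg : Measurable g) (hgD : ∀ ω ∈ D, g ω = c) (hgD' : ∀ ω ∉ D, g ω = ω) :
    IsMPC F (F.map hg.aemeasurable) := by
  have hi : ∀ h : I → ℝ, Continuous h →
      ∫ ω, h ω ∂((F.map hg.aemeasurable : ProbabilityMeasure I) : Measure I) =
      (F : Measure I).real D * h c + ∫ ω in Dᶜ, h ω ∂(F : Measure I) := fun h hh => by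
    have hint : ∀ f : I → I, Measurable f → Integrable (fun ω => h (f ω)) (F : Measure I) := by
      intro f hf
      obtain ⟨K, hK⟩ := (isCompact_range hh).isBounded.exists_norm_le
      exact Integrable.of_bound (hh.measurable.comp hf).aestronglyMeasurable K
        (Filter.Eventually.of_forall fun ω => hK _ (mem_range_self _))
    rw [ProbabilityMeasure.toMeasure_map, integral_map hg.aemeasurable
      hh.measurable.aestronglyMeasurable, ← integral_add_compl hD (hint g hg)]
    congr 1
    · rw [setIntegral_congr_fun hD (g := fun _ => h c) fun ω hω => by simp only [hgD ω hω]]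
      simp
    · exact setIntegral_congr_fun hD.compl fun ω hω => by simp only [hgD' ω hω]
  rw [isMPC_iff]
  refine ⟨fun x => ?_, ?_⟩
  · have hcont : Continuous fun ω : I => max ((x : ℝ) - ω) 0 := by fun_prop
    have hint : Integrable (fun ω : I => (x : ℝ) - ω) (F : Measure I) :=
      (integrable_const _).sub (integrable_coe _)
    have hintm : Integrable (fun ω : I => max ((x : ℝ) - ω) 0) (F : Measure I) :=
      hint.sup (integrable_const 0)
    rw [hi _ hcont, ← integral_add_compl hD hintm]
    gcongr
    rcases le_total ((x : ℝ) - c) 0 with h | h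
    · rw [max_eq_right h, mul_zero]
      exact integral_nonneg fun ω => le_max_right _ _
    · rw [max_eq_left h]
      calc (F : Measure I).real D * ((x : ℝ) - c) = ∫ ω in D, ((x : ℝ) - ω) ∂(F : Measure I) := by
            rw [integral_sub (integrable_const _) (integrable_coe _), hc]
            simp
            ring
        _ ≤ _ := integral_mono hint.integrableOn hintm.integrableOn fun ω => le_max_left _ _
  · rw [hi _ continuous_subtype_val, ← hc, integral_add_compl hD (integrable_coe _)]

namespace Environment

variable {E : Environment 2}

theorem IsOptimalSignal.measureReal_le {G : ProbabilityMeasure I} (hG : E.IsOptimalSignal G)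
    {D : Set I} (hD : MeasurableSet D) {c : I} (hle : E.cutoff 1 ≤ c)
    (hc : ∫ ω in D, (ω : ℝ) ∂(E.prior : Measure I) = (E.prior : Measure I).real D * c) :
    (E.prior : Measure I).real D ≤ (G : Measure I).real (Ici (E.cutoff 1)) := by
  classical
  have hg : Measurable (D.piecewise (fun _ => c) id) := measurable_const.piecewise hD measurable_id
  have h := hG.2 _ (isMPC_pool E.prior hD hc hg (fun ω hω => piecewise_eq_of_mem _ _ _ hω)
    fun ω hω => piecewise_eq_of_notMem _ _ _ hω)
  rw [integral_valueFn, integral_valueFn] at h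
  refine le_trans ?_ (le_of_mul_le_mul_right h E.v_one_pos)
  rw [ProbabilityMeasure.toMeasure_map, map_measureReal_apply hg measurableSet_Ici]
  refine measureReal_mono fun ω hω => ?_
  rw [mem_preimage, piecewise_eq_of_mem _ _ _ hω]
  exact hle

theorem prior_absolutelyContinuous (E : Environment 2) : (E.prior : Measure I) ≪ volume := by
  rw [E.prior_eq]
  exact withDensity_absolutelyContinuous _ _

theorem absolutelyContinuous_prior (E : Environment 2) : (volume : Measure I) ≪ E.prior := by
  rw [E.prior_eq]
  refine withDensity_absolutelyContinuous' ?_ ?_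
  · exact E.measurable_density.ennreal_ofReal.aemeasurable
  · exact Filter.Eventually.of_forall fun ω => (ENNReal.ofReal_pos.2 (E.density_pos ω)).ne'

theorem prior_singleton (E : Environment 2) (x : I) : (E.prior : Measure I) {x} = 0 :=
  E.prior_absolutelyContinuous (measure_singleton x)

theorem isEquilibriumOutcome_of_cutoff_le_mean {G : ProbabilityMeasure I}
    (hG : E.IsOptimalSignal G) (hγ : E.cutoff 1 ≤ mean (E.prior : Measure I)) :
    E.IsEquilibriumOutcome G E.commitmentPayoff := by
  obtain ⟨θ, hθ, hdom, hx, hbind⟩ := hG.1.exists_splitting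
  have hxm : Measurable fun t : I × I × I => t.2.1 := by fun_prop
  have hC : MeasurableSet {t : I × I × I | E.cutoff 1 ≤ t.2.1} := hxm measurableSet_Ici
  have hG1 : (G : Measure I) (Ici (E.cutoff 1)) = 1 := by
    have h := hG.measureReal_le MeasurableSet.univ hγ (by simp [coe_mean])
    rw [probReal_univ] at h
    have h1 := le_antisymm measureReal_le_one h
    rw [measureReal_def, ENNReal.toReal_eq_one_iff] at h1
    exact h1
  have hθC : ∀ᵐ t ∂θ, E.cutoff 1 ≤ t.2.1 := by
    have : ∀ᵐ x ∂(G : Measure I), E.cutoff 1 ≤ x := (prob_compl_eq_zero_iff measurableSet_Ici).2 hG1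
    rw [← hx] at this
    exact ae_of_ae_map hxm.aemeasurable this
  obtain ⟨p, hp, hsupp, hin, hcases⟩ := exists_belief hC measurable_highest highest_mem
  have hpθ : ∀ᵐ t ∂θ, p (tripleMessage t) = splitKernel t := by
    filter_upwards [hdom, hθC] with t h1 h2 using hin t ⟨h1, h2⟩
  have hmeanC : ∀ t ∈ splitDomain ∩ {t : I × I × I | E.cutoff 1 ≤ t.2.1},
      E.cutoff 1 ≤ highest (tripleMessage t) := fun t ht =>
    le_trans ht.2 (le_highest (mem_tripleMessage.2 (.inr (.inl rfl))))
  have hprob := Measure.isProbabilityMeasure_map (μ := θ) measurable_tripleMessage.aemeasurable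
  have htop : E.cutoff 1 ≤ highest (⊤ : Message) :=
    le_trans (E.cutoff 1).2.2 (le_highest (ω := 1) (mem_univ _))
  refine isEquilibriumOutcome_of_messageLaw hG (θ.map tripleMessage) p
    ((bind_map_tripleMessage hpθ).trans hbind) hsupp
    ((map_mean_map_tripleMessage hdom hpθ).trans hx)
    (W := {m | E.cutoff 1 ≤ highest m}) (isClosed_le_highest _).measurableSet
    (fun m hm => ?_) (fun m hm => ?_) (Filter.Eventually.of_forall fun m hm => ?_)
    (R := {z | z.1 ∈ z.2 ∧ E.cutoff 1 ≤ highest z.2})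
    (isClosed_mem.measurableSet.inter (measurable_snd (isClosed_le_highest _).measurableSet))
    (fun ω => (isClosed_mem_right ω).inter (isClosed_le_highest _))
    (fun ω m h => h.1) (fun ω m h hm => absurd h.2 hm) ?_
    (s := fun _ => ⊤) measurable_const (fun ω => ⟨mem_univ _, htop⟩)
  · rcases hcases m with ⟨t, ht, rfl⟩ | h
    · rw [mean_eq_of_eq_splitKernel ht.1 (hin t ht)]
      exact ht.2
    · rw [mean_eq_of_eq_dirac h]
      exact hm
  · rcases hcases m with ⟨t, ht, rfl⟩ | h
    · exact absurd (hmeanC t ht) hm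
    · rw [mean_eq_of_eq_dirac h]
      exact (not_le.1 hm).le
  · rcases hcases m with ⟨t, ht, rfl⟩ | h
    · exact hmeanC t ht
    · rwa [mean_eq_of_eq_dirac h] at hm
  · have : ∀ᵐ m ∂(θ.map tripleMessage), E.cutoff 1 ≤ highest m := by
      rw [ae_map_iff measurable_tripleMessage.aemeasurable (isClosed_le_highest _).measurableSet]
      filter_upwards [hdom, hθC] with t h1 h2 using hmeanC t ⟨h1, h2⟩
    filter_upwards [this] with m hm
    filter_upwards [hsupp m] with ω hω using ⟨hω, hm⟩

theorem isEquilibriumOutcome_of_cutoff_eq_one {G : ProbabilityMeasure I}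
    (hG : E.IsOptimalSignal G) (hγ : E.cutoff 1 = 1) :
    E.IsEquilibriumOutcome G E.commitmentPayoff := by
  obtain ⟨θ, hθ, hdom, hx, hbind⟩ := hG.1.exists_splitting
  obtain ⟨p, hp, hsupp, hin, -⟩ :=
    exists_belief MeasurableSet.univ measurable_highest highest_mem
  have hpθ : ∀ᵐ t ∂θ, p (tripleMessage t) = splitKernel t :=
    hdom.mono fun t ht => hin t ⟨ht, mem_univ t⟩
  have hprob := Measure.isProbabilityMeasure_map (μ := θ) measurable_tripleMessage.aemeasurable
  have hne : ∀ᵐ t ∂θ, t.2.1 ≠ 1 := by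
    have h1 : ∀ᵐ ω ∂(θ.bind splitKernel), ω ≠ 1 := by
      rw [hbind]
      exact measure_eq_zero_iff_ae_notMem.1 (E.prior_singleton 1)
    filter_upwards [hdom, Measure.ae_ae_of_ae_comp h1] with t ht h2 h3
    rcases ht with ht | ht
    · exact absurd (ht.2.trans_le (show t.2.2 ≤ 1 from t.2.2.2.2)) (by simp [h3])
    · have : t = (1, 1, 1) := by
        obtain ⟨a, x, b⟩ := t
        simp_all
      rw [this, splitKernel_apply_diag] at h2
      exact (ae_dirac_iff (measurableSet_singleton (1 : I)).compl).1 h2 rfl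
  refine isEquilibriumOutcome_of_messageLaw hG (θ.map tripleMessage) p
    ((bind_map_tripleMessage hpθ).trans hbind) hsupp
    ((map_mean_map_tripleMessage hdom hpθ).trans hx)
    (W := ∅) MeasurableSet.empty (fun m hm => absurd hm (notMem_empty m))
    (fun m _ => hγ ▸ (mean (p m)).2.2) ?_
    (R := {z | z.1 ∈ z.2}) isClosed_mem.measurableSet isClosed_mem_right
    (fun ω m h => h) (fun _ _ _ _ m' _ => notMem_empty m')
    (Filter.Eventually.of_forall hsupp) (s := fun _ => ⊤) measurable_const (fun ω => mem_univ ω)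
  rw [ae_map_iff measurable_tripleMessage.aemeasurable]
  · filter_upwards [hdom, hpθ, hne] with t h1 h2 h3 h4
    rw [mean_eq_of_eq_splitKernel h1 h2, hγ] at h4
    exact h3 (le_antisymm t.2.1.2.2 h4)
  · have : MeasurableSet {m | E.cutoff 1 ≤ mean (p m)} := measurable_mean p measurableSet_Ici
    exact this.compl

theorem prior_Ici_pos (E : Environment 2) {x : I} (hx : x < 1) :
    (E.prior : Measure I) (Ici x) ≠ 0 := fun h => by
  have h1 := E.absolutelyContinuous_prior h
  rw [unitInterval.volume_Ici, ENNReal.ofReal_eq_zero] at h1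
  have : (x : ℝ) < 1 := hx
  linarith

/-- If the cutoff exceeds the prior mean, then some upper tail of states has mean equal to it. -/
theorem exists_tail (hγ : mean (E.prior : Measure I) < E.cutoff 1) (hγ1 : E.cutoff 1 < 1) :
    ∃ c < E.cutoff 1, ∫ ω in Ici c, (ω : ℝ) ∂(E.prior : Measure I) =
      (E.prior : Measure I).real (Ici c) * E.cutoff 1 := by
  set F : Measure I := (E.prior : Measure I) with hF
  set γ := E.cutoff 1
  have hint : Integrable (fun ω : I => (ω : ℝ) - γ) F := (integrable_coe _).sub (integrable_const _)
  set h : I → ℝ := fun x => ∫ ω in Ici x, ((ω : ℝ) - γ) ∂F with hh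
  have hcont : Continuous h := by
    have heq : h = fun x => ∫ ω, (Ici x).indicator (fun ω : I => (ω : ℝ) - γ) ω ∂F := by
      ext x
      exact (integral_indicator measurableSet_Ici).symm
    rw [heq, continuous_iff_continuousAt]
    intro x
    refine continuousAt_of_dominated (bound := fun ω => ‖(ω : ℝ) - γ‖)
      (Filter.Eventually.of_forall fun y => ?_) (Filter.Eventually.of_forall fun y => ?_) hint.norm ?_
    · exact (hint.indicator measurableSet_Ici).aestronglyMeasurable
    · exact Filter.Eventually.of_forall fun ω => norm_indicator_le_norm_self _ _
    · have hne : ∀ᵐ ω ∂F, ω ≠ x := measure_eq_zero_iff_ae_notMem.1 (E.prior_singleton x)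
      filter_upwards [hne] with ω hω
      refine ContinuousAt.congr (f := fun _ => (Ici x).indicator (fun ω : I => (ω : ℝ) - γ) ω)
        continuousAt_const ?_
      rcases lt_or_gt_of_ne hω with hlt | hlt
      · filter_upwards [lt_mem_nhds hlt] with y hy
        simp [indicator, hlt.not_ge, (show y > ω from hy).not_ge]
      · filter_upwards [gt_mem_nhds hlt] with y hy
        simp [indicator, hlt.le, hy.le]
  have h0 : h 0 < 0 := by
    have : Ici (0 : I) = univ := eq_univ_of_forall fun x => x.2.1
    simp only [hh]
    rw [this, setIntegral_univ, integral_sub (integrable_coe _) (integrable_const _),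
      ← coe_mean]
    simpa using hγ
  have hγpos : 0 < h γ := by
    refine (setIntegral_pos_iff_support_of_nonneg_ae ?_ hint.integrableOn).2 ?_
    · exact (ae_restrict_mem measurableSet_Ici).mono fun ω hω => sub_nonneg.2 hω
    · have hle : F (Ici γ) ≤ F (Function.support (fun ω : I => (ω : ℝ) - γ) ∩ Ici γ) + F {γ} := by
        refine (measure_mono fun ω hω => ?_).trans (measure_union_le _ _)
        by_cases h : ω = γ
        · exact .inr h
        · exact .inl ⟨sub_ne_zero.2 fun h' => h (Subtype.ext h'), hω⟩
      rw [hF, E.prior_singleton, add_zero] at hle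
      exact (pos_iff_ne_zero.2 (E.prior_Ici_pos hγ1)).trans_le hle
  obtain ⟨c, hcmem, hc⟩ := intermediate_value_Icc (show (0 : I) ≤ γ from γ.2.1) hcont.continuousOn
    ⟨h0.le, hγpos.le⟩
  refine ⟨c, lt_of_le_of_ne hcmem.2 fun hcγ => ?_, ?_⟩
  · rw [hcγ] at hc
    exact hγpos.ne' hc
  · simp only [hh] at hc
    rw [integral_sub (integrable_coe _).integrableOn (integrable_const _)] at hc
    simp at hc
    linarith

/-- At an optimum, the posterior means at or above the cutoff are exactly the cutoff, and they are
induced precisely by the states in the upper tail whose mean is the cutoff. -/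
theorem IsOptimalSignal.ae_splitting {G : ProbabilityMeasure I} (hG : E.IsOptimalSignal G)
    {θ : Measure (I × I × I)} [IsProbabilityMeasure θ] (hdom : ∀ᵐ t ∂θ, t ∈ splitDomain)
    (hx : θ.map (fun t => t.2.1) = G) (hbind : θ.bind splitKernel = E.prior) {c : I}
    (hcγ : c < E.cutoff 1) (hc : ∫ ω in Ici c, (ω : ℝ) ∂(E.prior : Measure I) =
      (E.prior : Measure I).real (Ici c) * E.cutoff 1) :
    ∀ᵐ t ∂θ, (t.2.1 < E.cutoff 1 ∧ ∀ᵐ ω ∂(splitKernel t), ω < c) ∨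
      (t.2.1 = E.cutoff 1 ∧ ∀ᵐ ω ∂(splitKernel t), c ≤ ω) := by
  set F : Measure I := (E.prior : Measure I) with hF
  set γ := E.cutoff 1
  have hcγ' : (0 : ℝ) < (γ : ℝ) - c := sub_pos.2 hcγ
  have hxm : Measurable fun t : I × I × I => t.2.1 := by fun_prop
  have hint : ∀ (μ : Measure I) [IsFiniteMeasure μ], Integrable (fun ω : I => (ω : ℝ) - c) μ :=
    fun μ _ => (integrable_coe μ).sub (integrable_const _)
  have hintm : ∀ (μ : Measure I) [IsFiniteMeasure μ],
      Integrable (fun ω : I => max ((ω : ℝ) - c) 0) μ :=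
    fun μ _ => (hint μ).sup (integrable_const 0)
  set k : I × I × I → ℝ := fun t => ∫ ω, max ((ω : ℝ) - c) 0 ∂(splitKernel t) with hk
  have hkF : ∫ t, k t ∂θ = ((γ : ℝ) - c) * F.real (Ici c) := by
    have h1 : ∫ t, k t ∂θ = ∫ ω, max ((ω : ℝ) - c) 0 ∂F := by
      have hprod : Integrable (fun z : (I × I × I) × I => max ((z.2 : ℝ) - c) 0)
          (θ ⊗ₘ splitKernel) :=
        (Measure.integrable_compProd_snd_iff (by rw [hbind]; exact (hintm F).1)).2
          (by rw [hbind]; exact hintm F)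
      rw [hk, ← Measure.integral_compProd hprod, ← hbind, ← Measure.snd_compProd, Measure.snd,
        integral_map measurable_snd.aemeasurable (by fun_prop)]
    have h2 : ∫ ω, max ((ω : ℝ) - c) 0 ∂F = ∫ ω in Ici c, ((ω : ℝ) - c) ∂F := by
      rw [← integral_indicator measurableSet_Ici]
      refine integral_congr_ae (Filter.Eventually.of_forall fun ω => ?_)
      simp only [indicator, mem_Ici]
      split_ifs with h
      · exact max_eq_left (sub_nonneg.2 h)
      · exact max_eq_right (sub_nonpos.2 (not_le.1 h).le)
    rw [h1, h2, integral_sub (integrable_coe _).integrableOn (integrable_const _), hc]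
    simp
    ring
  have hki : Integrable k θ := by
    refine Integrable.of_bound (C := 1) ?_ (Filter.Eventually.of_forall fun t => ?_)
    · exact (StronglyMeasurable.integral_kernel (f := fun ω : I => max ((ω : ℝ) - c) 0)
        (Measurable.stronglyMeasurable (by fun_prop))).aestronglyMeasurable
    · have h0 : 0 ≤ k t := integral_nonneg fun ω => le_max_right _ _
      rw [Real.norm_eq_abs, abs_of_nonneg h0]
      have h1 : k t ≤ ∫ _, (1 : ℝ) ∂(splitKernel t) := integral_mono (hintm _) (integrable_const 1)
        fun ω => max_le (by have := ω.2.2; have := c.2.1; simp only; linarith) zero_le_one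
      simpa using h1
  have hge : ∀ t ∈ splitDomain, γ ≤ t.2.1 → (t.2.1 : ℝ) - c ≤ k t := fun t ht _ => by
    calc (t.2.1 : ℝ) - c = ∫ ω, ((ω : ℝ) - c) ∂(splitKernel t) := by
          rw [integral_sub (integrable_coe _) (integrable_const _), integral_splitKernel ht]
          simp
      _ ≤ k t := integral_mono (hint _) (hintm _) fun ω => le_max_left _ _
  set U : Set (I × I × I) := {t | γ ≤ t.2.1} with hU
  have hUm : MeasurableSet U := hxm measurableSet_Ici
  set r : I × I × I → ℝ := U.indicator fun _ => (γ : ℝ) - c with hr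
  have hri : Integrable r θ := (integrable_const _).indicator hUm
  have hrG : ∫ t, r t ∂θ = ((γ : ℝ) - c) * (G : Measure I).real (Ici γ) := by
    rw [hr, integral_indicator hUm, ← hx, map_measureReal_apply hxm measurableSet_Ici]
    rw [integral_const, smul_eq_mul, measureReal_restrict_apply_univ, mul_comm]
    rfl
  have hrk : r ≤ᵐ[θ] k := by
    filter_upwards [hdom] with t ht
    simp only [hr, indicator]
    split_ifs with h
    · have h' : (γ : ℝ) ≤ t.2.1 := h
      linarith [hge t ht h]
    · exact integral_nonneg fun ω => le_max_right _ _
  have heq : r =ᵐ[θ] k := by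
    refine (integral_eq_iff_of_ae_le hri hki hrk).1 (le_antisymm (integral_mono_ae hri hki hrk) ?_)
    rw [hkF, hrG]
    exact mul_le_mul_of_nonneg_left (hG.measureReal_le measurableSet_Ici le_rfl hc) hcγ'.le
  have hnull : ∀ᵐ t ∂θ, ∀ᵐ ω ∂(splitKernel t), ω ≠ c := by
    refine Measure.ae_ae_of_ae_comp ?_
    rw [hbind]
    exact measure_eq_zero_iff_ae_notMem.1 (E.prior_singleton c)
  filter_upwards [hdom, heq, hnull] with t ht hrt hnt
  by_cases htU : t ∈ U
  · refine .inr ?_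
    have h1 : k t = (γ : ℝ) - c := by rw [← hrt, hr, indicator_of_mem htU]
    have h2 := hge t ht htU
    have hxt : t.2.1 = γ := le_antisymm (Subtype.coe_le_coe.1 (by linarith)) htU
    refine ⟨hxt, ?_⟩
    have h3 : ∫ ω, ((ω : ℝ) - c) ∂(splitKernel t) = k t := by
      rw [integral_sub (integrable_coe _) (integrable_const _), integral_splitKernel ht, h1, hxt]
      simp
    have h4 := (integral_eq_iff_of_ae_le (hint (splitKernel t)) (hintm (splitKernel t))
      (Filter.Eventually.of_forall fun ω => le_max_left _ _)).1 h3
    filter_upwards [h4] with ω hω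
    have : (0 : ℝ) ≤ (ω : ℝ) - c := by
      rw [hω]
      exact le_max_right _ _
    exact Subtype.coe_le_coe.1 (sub_nonneg.1 this)
  · refine .inl ⟨not_le.1 htU, ?_⟩
    have h1 : k t = 0 := by rw [← hrt, hr, indicator_of_notMem htU]
    have h2 := (integral_eq_zero_iff_of_nonneg (fun ω => le_max_right _ _)
      (hintm (splitKernel t))).1 h1
    filter_upwards [h2, hnt] with ω hω hne
    have : (ω : ℝ) - c ≤ 0 := max_eq_right_iff.1 hω
    exact lt_of_le_of_ne (Subtype.coe_le_coe.1 (sub_nonpos.1 this)) hne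

/-- The message disclosing that the state is at least `c`. -/
def tailMessage (c : I) : Message :=
  ⟨⟨Icc c 1, isCompact_Icc⟩, c, left_mem_Icc.2 c.2.2⟩

theorem mem_tailMessage {c ω : I} : ω ∈ tailMessage c ↔ c ≤ ω :=
  ⟨fun h => h.1, fun h => ⟨h, ω.2.2⟩⟩

theorem tripleMessage_ne_tailMessage {c : I} (hc : c < 1) (t : I × I × I) :
    tripleMessage t ≠ tailMessage c := fun h => by
  refine Icc_infinite hc ((toFinite {t.1, t.2.1, t.2.2}).subset fun ω hω => ?_)
  have : ω ∈ tripleMessage t := by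
    rw [h]
    exact hω
  simpa using mem_tripleMessage.1 this

theorem isEquilibriumOutcome_of_mean_lt_cutoff {G : ProbabilityMeasure I}
    (hG : E.IsOptimalSignal G) (hγ : mean (E.prior : Measure I) < E.cutoff 1)
    (hγ1 : E.cutoff 1 < 1) : E.IsEquilibriumOutcome G E.commitmentPayoff := by
  classical
  obtain ⟨c, hcγ, hc⟩ := exists_tail hγ hγ1
  obtain ⟨θ, hθ, hdom, hx, hbind⟩ := hG.1.exists_splitting
  have hae := hG.ae_splitting hdom hx hbind hcγ hc
  set F : Measure I := (E.prior : Measure I) with hF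
  set γ := E.cutoff 1 with hγdef
  have hFc : F (Ici c) ≠ 0 := E.prior_Ici_pos (hcγ.trans hγ1)
  have hxm : Measurable fun t : I × I × I => t.2.1 := by fun_prop
  set L : Set (I × I × I) := {t | t.2.1 < γ} with hL
  have hLm : MeasurableSet L := hxm measurableSet_Iio
  have hdomL : ∀ᵐ t ∂(θ.restrict L), t ∈ splitDomain := ae_restrict_of_ae hdom
  have hlow : ∀ᵐ t ∂(θ.restrict L), ∀ᵐ ω ∂(splitKernel t), ω < c := by
    filter_upwards [ae_restrict_of_ae hae, ae_restrict_mem hLm] with t h1 h2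
    rcases h1 with h1 | h1
    · exact h1.2
    · exact absurd h1.1 (ne_of_lt h2)
  have hhigh : ∀ᵐ t ∂(θ.restrict Lᶜ), t.2.1 = γ ∧ ∀ᵐ ω ∂(splitKernel t), c ≤ ω := by
    filter_upwards [ae_restrict_of_ae hae, ae_restrict_mem hLm.compl] with t h1 h2
    rcases h1 with h1 | h1
    · exact absurd h1.1 h2
    · exact h1
  have hbindL : (θ.restrict L).bind splitKernel = F.restrict (Iio c) := by
    ext A hA
    rw [Measure.restrict_apply hA, ← hbind,
      Measure.bind_apply hA splitKernel.measurable.aemeasurable,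
      Measure.bind_apply (hA.inter measurableSet_Iio) splitKernel.measurable.aemeasurable,
      ← lintegral_add_compl (fun t => splitKernel t (A ∩ Iio c)) hLm]
    have h1 : ∫⁻ t in Lᶜ, splitKernel t (A ∩ Iio c) ∂θ = 0 := by
      refine (lintegral_congr_ae (hhigh.mono fun t ht => ?_)).trans lintegral_zero
      refine measure_mono_null inter_subset_right ?_
      have h := ht.2
      simp only [ae_iff, not_le] at h
      exact h
    rw [h1, add_zero]
    refine lintegral_congr_ae (hlow.mono fun t ht => ?_)
    refine measure_congr ?_
    filter_upwards [ht] with ω hω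
    exact propext ⟨fun h => ⟨h, hω⟩, fun h => h.1⟩
  have hmass : θ Lᶜ = F (Ici c) := by
    have h1 : θ L = F (Iio c) := by
      have := congrArg (fun μ : Measure I => μ univ) hbindL
      simpa [Measure.bind_apply MeasurableSet.univ splitKernel.measurable.aemeasurable] using this
    rw [prob_compl_eq_one_sub hLm, h1, ← prob_compl_eq_one_sub measurableSet_Iio, compl_Iio]
  set H : Measure I := F[|Ici c] with hH
  have hHprob : IsProbabilityMeasure H := cond_isProbabilityMeasure hFc
  have hHsmul : F (Ici c) • H = F.restrict (Ici c) := by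
    rw [hH, ProbabilityTheory.cond, smul_smul, ENNReal.mul_inv_cancel hFc (measure_ne_top _ _),
      one_smul]
  have hHae : ∀ᵐ ω ∂H, c ≤ ω := by
    rw [hH, ProbabilityTheory.cond]
    exact Measure.ae_smul_measure (ae_restrict_mem measurableSet_Ici) _
  have hHmean : mean H = γ := by
    refine Subtype.ext ?_
    have hpos : F.real (Ici c) ≠ 0 := (measureReal_ne_zero_iff (measure_ne_top _ _)).2 hFc
    have h1 : F.real (Ici c) * ∫ ω, (ω : ℝ) ∂H = F.real (Ici c) * γ := by
      rw [← hc, ← hHsmul, integral_smul_measure]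
      rfl
    exact mul_left_cancel₀ hpos h1
  obtain ⟨p, hp, hsupp, hin, hcases⟩ := exists_belief hLm measurable_lowest lowest_mem
  set M : Message := tailMessage c with hM
  have hMsing : MeasurableSet {M} := measurableSet_singleton M
  set b : Kernel Message I := Kernel.piecewise hMsing (Kernel.const _ H) p with hb
  have hbM : b M = H := by
    rw [hb, Kernel.piecewise_apply, if_pos (mem_singleton M), Kernel.const_apply]
  have hbne : ∀ m, m ≠ M → b m = p m := fun m hm => by
    rw [hb, Kernel.piecewise_apply, if_neg (by simpa using hm)]
  have hbt : ∀ t ∈ splitDomain ∩ L, b (tripleMessage t) = splitKernel t := fun t ht => by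
    rw [hbne _ (tripleMessage_ne_tailMessage (hcγ.trans hγ1) t), hin t ht]
  have hbθ : ∀ᵐ t ∂(θ.restrict L), b (tripleMessage t) = splitKernel t := by
    filter_upwards [hdomL, ae_restrict_mem hLm] with t h1 h2 using hbt t ⟨h1, h2⟩
  have hlowest : ∀ t ∈ splitDomain ∩ L, lowest (tripleMessage t) < γ := fun t ht =>
    (lowest_le (mem_tripleMessage.2 (.inr (.inl rfl)))).trans_lt ht.2
  have hmeanM : mean (b M) = γ := by
    rw [← hHmean]
    exact Subtype.ext (by rw [coe_mean, coe_mean, hbM])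
  have hbcases : ∀ m, m ≠ M → (∃ t ∈ splitDomain ∩ L, m = tripleMessage t ∧
      mean (b m) = t.2.1) ∨ mean (b m) = lowest m := fun m hm => by
    rcases hcases m with ⟨t, ht, rfl⟩ | h
    · exact .inl ⟨t, ht, rfl, mean_eq_of_eq_splitKernel ht.1 (hbt t ht)⟩
    · exact .inr (mean_eq_of_eq_dirac ((hbne m hm).trans h))
  set Λ : Measure Message :=
    (θ.restrict L).map tripleMessage + F (Ici c) • Measure.dirac M with hΛ
  have hΛbind : Λ.bind b = F := by
    rw [hΛ, Measure.comp_add, Measure.comp_smul, bind_map_tripleMessage hbθ, hbindL,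
      Measure.dirac_bind b.measurable, hbM, hHsmul, ← compl_Iio,
      Measure.restrict_add_restrict_compl measurableSet_Iio]
  have hΛprob : IsProbabilityMeasure Λ := ⟨by
    have := congrArg (fun μ : Measure I => μ univ) hΛbind
    simpa [Measure.bind_apply MeasurableSet.univ b.measurable.aemeasurable] using this⟩
  have hbsupp : ∀ m, ∀ᵐ ω ∂(b m), ω ∈ m := fun m => by
    by_cases hm : m = M
    · rw [hm, hbM]
      exact hHae.mono fun ω hω => mem_tailMessage.2 hω
    · rw [hbne m hm]
      exact hsupp m
  have hout : Λ.map (fun m => mean (b m)) = G := by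
    rw [hΛ, Measure.map_add _ _ (measurable_mean b), Measure.map_smul,
      map_mean_map_tripleMessage hdomL hbθ, Measure.map_dirac' (measurable_mean b), hmeanM, ← hx,
      ← hmass]
    conv_rhs => rw [← Measure.restrict_add_restrict_compl (μ := θ) hLm, Measure.map_add _ _ hxm]
    congr 1
    rw [Measure.map_congr (g := fun _ => γ) (hhigh.mono fun t ht => ht.1), Measure.map_const,
      Measure.restrict_apply_univ]
  have hWm : MeasurableSet {m : Message | m = M ∨ γ < lowest m} :=
    hMsing.union (measurable_lowest measurableSet_Ioi)
  have hRm : MeasurableSet {z : I × Message | z.1 ∈ z.2 ∧ (c ≤ z.1 → z.2 = M)} := by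
    have : {z : I × Message | z.1 ∈ z.2 ∧ (c ≤ z.1 → z.2 = M)} =
        {z | z.1 ∈ z.2} ∩ (Prod.fst ⁻¹' Iio c ∪ Prod.snd ⁻¹' {M}) := by
      ext z
      simp only [mem_ofPred_eq, mem_inter_iff, mem_union, mem_preimage, mem_Iio, mem_singleton_iff,
        ← not_le, imp_iff_not_or]
    rw [this]
    exact isClosed_mem.measurableSet.inter
      ((measurable_fst measurableSet_Iio).union (measurable_snd hMsing))
  refine isEquilibriumOutcome_of_messageLaw hG Λ b hΛbind hbsupp hout hWm
    (fun m hm => ?_) (fun m hm => ?_) ?_ hRm (fun ω => ?_) (fun ω m h => h.1)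
    (fun ω m h hm m' hm' => ?_) ?_ (s := fun ω => if c ≤ ω then M else ⊤)
    (Measurable.ite measurableSet_Ici measurable_const measurable_const) (fun ω => ?_)
  · by_cases hmM : m = M
    · rw [hmM]
      exact hmeanM.ge
    · have hlt : γ < lowest m := hm.resolve_left hmM
      rcases hbcases m hmM with ⟨t, ht, rfl, -⟩ | h
      · exact absurd hlt (hlowest t ht).not_gt
      · rw [h]
        exact hlt.le
  · obtain ⟨hmM, hle⟩ := not_or.1 hm
    rcases hbcases m hmM with ⟨t, ht, rfl, h⟩ | h
    · rw [h]
      exact ht.2.le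
    · rw [h]
      exact not_lt.1 hle
  · rw [hΛ, ae_add_measure_iff]
    have hm : MeasurableSet {m | γ ≤ mean (b m) → m ∈ {m : Message | m = M ∨ γ < lowest m}} :=
      (measurable_mean b measurableSet_Ici).imp hWm
    refine ⟨?_, Measure.ae_smul_measure ((ae_dirac_iff hm).2 fun _ => .inl rfl) _⟩
    rw [ae_map_iff measurable_tripleMessage.aemeasurable hm]
    filter_upwards [hdomL, ae_restrict_mem hLm] with t h1 h2 h3
    rw [mean_eq_of_eq_splitKernel h1 (hbt t ⟨h1, h2⟩)] at h3
    exact absurd h2 h3.not_gt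
  · by_cases hω : c ≤ ω
    · have : {m : Message | (ω, m) ∈ {z : I × Message | z.1 ∈ z.2 ∧ (c ≤ z.1 → z.2 = M)}} = {M} := by
        ext m
        exact ⟨fun h => h.2 hω, fun h => ⟨h ▸ mem_tailMessage.2 hω, fun _ => h⟩⟩
      rw [this]
      exact isClosed_singleton
    · have : {m : Message | (ω, m) ∈ {z : I × Message | z.1 ∈ z.2 ∧ (c ≤ z.1 → z.2 = M)}} =
          {m | ω ∈ m} := by
        ext m
        exact ⟨fun h => h.1, fun h => ⟨h, fun h' => absurd h' hω⟩⟩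
      rw [this]
      exact isClosed_mem_right ω
  · have hω : ¬ c ≤ ω := fun hω => hm (.inl (h.2 hω))
    rintro (rfl | hlt)
    · exact hω (mem_tailMessage.1 hm')
    · exact absurd (hlt.trans_le (lowest_le hm')) ((not_le.1 hω).trans hcγ).not_gt
  · have hm : MeasurableSet {m | ∀ᵐ ω ∂(b m), (ω, m) ∈
        {z : I × Message | z.1 ∈ z.2 ∧ (c ≤ z.1 → z.2 = M)}} :=
      (Kernel.measurable_kernel_prodMk_left (κ := b) (measurable_swap hRm).compl)
        (measurableSet_singleton 0)
    rw [hΛ, ae_add_measure_iff]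
    refine ⟨?_, Measure.ae_smul_measure ((ae_dirac_iff hm).2 ?_) _⟩
    · rw [ae_map_iff measurable_tripleMessage.aemeasurable hm]
      filter_upwards [hbθ, hlow] with t h1 h2
      have h3 := hbsupp (tripleMessage t)
      rw [← h1] at h2
      filter_upwards [h3, h2] with ω h4 h5 using ⟨h4, fun h6 => absurd h5 h6.not_gt⟩
    · filter_upwards [hbsupp M] with ω hω using ⟨hω, fun _ => rfl⟩
  · by_cases hω : c ≤ ω
    · simp only [if_pos hω]
      exact ⟨mem_tailMessage.2 hω, fun _ => rfl⟩
    · simp only [if_neg hω]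
      exact ⟨mem_univ ω, fun h => absurd h hω⟩

end Environment

end VerifiableDisclosure

theorem corollary1 (E : VerifiableDisclosure.Environment 2)
    (G : ProbabilityMeasure unitInterval) (hG : E.IsBiPoolingSolution G) :
    E.Implementable G := by
  refine ⟨hG.2, ?_⟩
  rcases le_or_gt (E.cutoff 1) (VerifiableDisclosure.mean (E.prior : Measure unitInterval)) with h | h
  · exact VerifiableDisclosure.Environment.isEquilibriumOutcome_of_cutoff_le_mean hG.2 h
  · rcases lt_or_eq_of_le (show E.cutoff 1 ≤ 1 from (E.cutoff 1).2.2) with h1 | h1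
    · exact VerifiableDisclosure.Environment.isEquilibriumOutcome_of_mean_lt_cutoff hG.2 h h1
    · exact VerifiableDisclosure.Environment.isEquilibriumOutcome_of_cutoff_eq_one hG.2 h1
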